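/- **Theorem 4.3.** *Setting.* Let $X$ and $Y$ be real Banach spaces with $X$ infinite-dimensional (complex Banach spaces are regarded as real ones), and let $Z$ be a separable normed space with $Z^*=X$ (isometrically). Let $G:X\to X$ be a bounded linear operator that is one-to-one, has an unbounded inverse $G^{-1}:\mathcal R(G)\to X$, is of positive type, i.e. for some constant $\kappa_*>0$ and all $\beta>0$ the operator $G+\beta I:X\to X$ is bijective with $\|(G+\beta I)^{-1}\|\le\kappa_*/\beta$, and has a pre-adjoint, i.e. a bounded linear $\tilde G:Z\to Z$ with $\tilde G^*=G$. Put $G^0=I$, $$G^pu=\frac{\sin \pi p}{\pi}\int_0^\infty s^{p-1}(G+sI)^{-1}Gu\,ds\quad(0<p<1),\qquad G^p=G^{p-\lfloor p\rfloor}G^{\lfloor p\rfloor}\quad(p\ge1),$$ and let $X_\tau=\mathcal R(G^\tau)$ for $\tau>0$, $X_\tau=X$ for $\tau\le0$, with $\|u\|_\tau=\|G^{-\tau}u\|$ for $u\in X_\tau$, where $G^{-\tau}=(G^\tau)^{-1}$ for $\tau>0$. Let $\mathcal D(\log G)$ be the set of all $u\in X$ for which $\lim_{p\downarrow0}\frac1p(G^pu-u)$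 exists in $X$. Let $F:X\supset\mathcal D(F)\to Y$ be such that $\mathcal D(F)$ is sequentially weak*-closed, and such that $u_n\rightharpoonup^*u_0$ with $u_n,u_0\in\mathcal D(F)$ implies $F(u_n)\rightharpoonup F(u_0)$ weakly in $Y$. Let $\mathcal D=\mathcal D(F)\cap X_1\ne\varnothing$, let $u^\dagger$ be an interior point of $\mathcal D(F)$, $f^\dagger=F(u^\dagger)$, and let $\bar u\in X_1\cap\mathcal D(F)$. Suppose that there are constants $a>0$, $0<c_a\le C_a$, $c_0,c_1>0$ such that for all $u\in\mathcal D$: $$\|u-u^\dagger\|_{-a}\le c_0\ \Rightarrow\ \|F(u)-f^\dagger\|\le C_a\|u-u^\dagger\|_{-a},\qquad \|F(u)-f^\dagger\|\le c_1\ \Rightarrow\ c_a\|u-u^\dagger\|_{-a}\le\|F(u)-f^\dagger\|.$$ Let $r>0$. For $\delta>0$, data $f^\delta\in Y$ with $\|f^\delta-f^\dagger\|\le\delta$, and $0<\alpha<\infty$, let $u^\delta_\alpha$ denote any minimizer over $u\in\mathcal D(F)$ of $$\|F(u)-f^\delta\|^r+\alpha\|u-\bar u\|_1^r\qquad(\|u-\bar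 u\|_1=+\infty\text{ if }u\notin X_1),$$ and put $u^\delta_\infty=\bar u$. Let $e_r=1$ if $r\ge1$ and $e_r=2^{-1+1/r}$ if $0<r<1$, and fix constants $b>e_r$ and $c>1$. The parameter $\alpha_*=\alpha_*(\delta,f^\delta)\in(0,\infty]$ is chosen by the discrepancy principle: if $\|F(\bar u)-f^\delta\|\le b\delta$, then $\alpha_*=\infty$; otherwise $0<\alpha_*<\infty$ is such that $$\|F(u^\delta_{\alpha_*})-f^\delta\|\le b\delta\le\|F(u^\delta_{\beta})-f^\delta\|\quad\text{for some }\beta\in[\alpha_*,c\,\alpha_*].$$ *Conclusion.* The following holds as $\delta\to0$, uniformly with respect to the data $f^\delta$ with $\|f^\delta-f^\dagger\|\le\delta$, the admissible parameters $\alpha_*$ and the minimizers. 1. If $u^\dagger\in\overline{\mathcal R(G)}$, then $\|u^\delta_{\alpha_*}-u^\dagger\|\to0$. 2. If $u^\dagger\in X_p$ for some $0<p\le1$, then $\|u^\delta_{\alpha_*}-u^\dagger\|=O(\delta^{p/(p+a)})$. 3. If $u^\dagger\in\mathcal D(\log G)$, then $\|u^\delta_{\alpha_*}-u^\dagger\|=O\big(1/\log(1/\delta)\big)$.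 -/

import Mathlib

open Set Filter Topology MeasureTheory
open scoped ENNReal

namespace BanachScale

noncomputable section

section Generator

variable {X : Type*} [NormedAddCommGroup X] [NormedSpace ℝ X]

/-- A bounded operator `G` is of positive type: for every `β > 0` the operator `G + β I` is
one-to-one and onto, and `‖(G + β I)⁻¹‖ ≤ κ / β` with one finite constant `κ > 0`. -/
def IsPositiveType (G : X →L[ℝ] X) : Prop :=
  ∃ κ : ℝ, 0 < κ ∧ ∀ β : ℝ, 0 < β →
    Function.Bijective (G + β • (1 : X →L[ℝ] X)) ∧
      ‖Ring.inverse (G + β • (1 : X →L[ℝ] X))‖ ≤ κ / β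

/-- The requirements on the generator of the scale: one-to-one, with an inverse
(defined on the range) that is unbounded, and of positive type. -/
structure IsScaleGenerator (G : X →L[ℝ] X) : Prop where
  injective : Function.Injective G
  unbounded_inverse : ¬ ∃ C : ℝ, ∀ u : X, ‖u‖ ≤ C * ‖G u‖
  positiveType : IsPositiveType G

/-- The Balakrishnan formula
`G^q u = (sin (π q) / π) ∫₀^∞ s^(q-1) (G + s I)⁻¹ G u ds`, meant for `0 < q < 1`. -/
def balakrishnan (G : X →L[ℝ] X) (q : ℝ) (u : X) : X :=
  (Real.sin (Real.pi * q) / Real.pi) •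
    ∫ s in Ioi (0 : ℝ), s ^ (q - 1) • (Ring.inverse (G + s • (1 : X →L[ℝ] X))) (G u)

/-- The power `G^p` for real `p ≥ 0`: the usual power if `p` is an integer (so `G^0 = I`), and
`G^(p - ⌊p⌋) G^⌊p⌋` otherwise, the fractional factor being given by the Balakrishnan formula. -/
def fracPow (G : X →L[ℝ] X) (p : ℝ) (u : X) : X :=
  if Int.fract p = 0 then (G ^ ⌊p⌋₊) u else balakrishnan G (Int.fract p) ((G ^ ⌊p⌋₊) u)

/-- The space `X_τ` of the scale: the range of `G^τ` for `τ > 0`, and `X` for `τ ≤ 0`. -/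
def scaleSpace (G : X →L[ℝ] X) (τ : ℝ) : Set X :=
  if 0 < τ then range (fracPow G τ) else univ

/-- The norm `‖u‖_τ = ‖G^(-τ) u‖` on `X_τ`, where `G^(-τ) = (G^τ)⁻¹` for `τ > 0`. -/
def scaleNorm (G : X →L[ℝ] X) (τ : ℝ) (u : X) : ℝ :=
  if 0 < τ then ‖Function.invFun (fracPow G τ) u‖ else ‖fracPow G (-τ) u‖

/-- The domain of `log G`, the infinitesimal generator of the semigroup `p ↦ G^p`. -/
def logDomain (G : X →L[ℝ] X) : Set X :=
  {u | ∃ v : X, Tendsto (fun p : ℝ => p⁻¹ • (fracPow G p u - u)) (𝓝[>] 0) (𝓝 v)}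

end Generator

section Convergence

variable {X Y Z : Type*} [NormedAddCommGroup X] [NormedSpace ℝ X]
  [NormedAddCommGroup Y] [NormedSpace ℝ Y] [NormedAddCommGroup Z] [NormedSpace ℝ Z]

/-- Weak* convergence of a sequence in `X`, where `J` identifies `X` with the dual of `Z`. -/
def WeakStarTendsto (J : X ≃ₗᵢ[ℝ] StrongDual ℝ Z) (u : ℕ → X) (u₀ : X) : Prop :=
  ∀ z : Z, Tendsto (fun n => J (u n) z) atTop (𝓝 (J u₀ z))

/-- Weak convergence of a sequence in `Y`. -/
def WeakTendsto (y : ℕ → Y) (y₀ : Y) : Prop :=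
  ∀ φ : StrongDual ℝ Y, Tendsto (fun n => φ (y n)) atTop (𝓝 (φ y₀))

/-- The assumptions on the spaces, the forward operator `F` with domain `D`, the generator `G`,
the solution `udag` with exact data `fdag`, and the initial guess `ubar`. The values of `F` outside
`D` play no role. The space `X` is the dual of `Z` by means of `J`. -/
structure MainAssumption (J : X ≃ₗᵢ[ℝ] StrongDual ℝ Z) (G : X →L[ℝ] X) (F : X → Y) (D : Set X)
    (fdag : Y) (udag ubar : X) (a ca cb c₀ c₁ : ℝ) : Prop where
  infinite_dimensional : ¬ FiniteDimensional ℝ X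
  generator : IsScaleGenerator G
  weakStar_weak_continuous : ∀ (u : ℕ → X) (u₀ : X), (∀ n, u n ∈ D) → u₀ ∈ D →
    WeakStarTendsto J u u₀ → WeakTendsto (fun n => F (u n)) (F u₀)
  weakStar_closed : ∀ (u : ℕ → X) (u₀ : X), (∀ n, u n ∈ D) → WeakStarTendsto J u u₀ → u₀ ∈ D
  nonempty : (D ∩ scaleSpace G 1).Nonempty
  solution : F udag = fdag
  solution_interior : udag ∈ interior D
  guess_mem : ubar ∈ scaleSpace G 1 ∩ D
  a_pos : 0 < a
  ca_pos : 0 < ca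
  ca_le_cb : ca ≤ cb
  c₀_pos : 0 < c₀
  c₁_pos : 0 < c₁
  upper : ∀ u ∈ D ∩ scaleSpace G 1, scaleNorm G (-a) (u - udag) ≤ c₀ →
    ‖F u - fdag‖ ≤ cb * scaleNorm G (-a) (u - udag)
  lower : ∀ u ∈ D ∩ scaleSpace G 1, ‖F u - fdag‖ ≤ c₁ →
    ca * scaleNorm G (-a) (u - udag) ≤ ‖F u - fdag‖
  preadjoint : ∃ G' : Z →L[ℝ] Z, ∀ (u : X) (z : Z), J (G u) z = J u (G' z)

end Convergence

section Regularization

variable {X Y : Type*} [NormedAddCommGroup X] [NormedSpace ℝ X] [NormedAddCommGroup Y]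

open Classical in
/-- The penalty `‖u - ubar‖₁ ^ r`, which is `+∞` outside `X₁`
(here `u - ubar ∈ X₁` iff `u ∈ X₁`, as `ubar ∈ X₁`). -/
def penalty (G : X →L[ℝ] X) (r : ℝ) (ubar u : X) : ℝ≥0∞ :=
  if u ∈ scaleSpace G 1 then ENNReal.ofReal (scaleNorm G 1 (u - ubar) ^ r) else ⊤

/-- The Tikhonov functional `‖F u - f‖ ^ r + α ‖u - ubar‖₁ ^ r` for the data `f`. -/
def tikhonov (G : X →L[ℝ] X) (F : X → Y) (r : ℝ) (ubar : X) (f : Y) (α : ℝ) (u : X) : ℝ≥0∞ :=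
  ENNReal.ofReal (‖F u - f‖ ^ r) + ENNReal.ofReal α * penalty G r ubar u

/-- `u` is a regularized solution for the parameter `α` and the data `f`: it minimizes the
Tikhonov functional over the domain `D` of `F`. -/
def IsRegularizedSolution (G : X →L[ℝ] X) (F : X → Y) (D : Set X) (r : ℝ) (ubar : X) (f : Y)
    (α : ℝ) (u : X) : Prop :=
  u ∈ D ∧ ∀ v ∈ D, tikhonov G F r ubar f α u ≤ tikhonov G F r ubar f α v

/-- The threshold `e_r` for the constant of the discrepancy principle. -/
def thresholdConst (r : ℝ) : ℝ := if 1 ≤ r then 1 else (2 : ℝ) ^ (-1 + 1 / r)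

/-- The discrepancy principle with constants `b` and `c`, noise level `δ` and data `f` admits the
parameter `α ∈ (0, ∞]` and the corresponding regularized solution `u`. -/
def IsDiscrepancyChoice (G : X →L[ℝ] X) (F : X → Y) (D : Set X) (r : ℝ) (ubar : X)
    (b c δ : ℝ) (f : Y) (α : WithTop ℝ) (u : X) : Prop :=
  (‖F ubar - f‖ ≤ b * δ ∧ α = ⊤ ∧ u = ubar) ∨
  (b * δ < ‖F ubar - f‖ ∧ ∃ α₀ : ℝ, α = (α₀ : WithTop ℝ) ∧ 0 < α₀ ∧
    IsRegularizedSolution G F D r ubar f α₀ u ∧ ‖F u - f‖ ≤ b * δ ∧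
    ∃ (β : ℝ) (v : X), α₀ ≤ β ∧ β ≤ c * α₀ ∧
      IsRegularizedSolution G F D r ubar f β v ∧ b * δ ≤ ‖F v - f‖)

end Regularization

end

end BanachScale

/-!
Write `L = γ (G + γ I)⁻¹`, a filter that keeps the part of the spectrum of `G` below `γ`. The proof
compares the regularized solution `u` with the element `û = udag - L ^ m (udag - ubar)`, where
`m = ⌊a⌋ + 2`.

If `‖L (udag - ubar)‖ ≤ φ`, then `û` is at distance `O(φ)` from `udag` in the norm of `X`, at
distance `O(γ ^ a φ)` in the norm `‖·‖_{-a}`, and `‖û - ubar‖_1 = O(φ / γ)`. If `γ ^ a φ` is at most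
a small multiple of `δ`, the residual of `û` is at most `b' δ` with `b' < b`. Minimality at the
parameter `β`, where the residual is at least `b δ`, compares `δ ^ r` with `α ‖û - ubar‖_1 ^ r`, and
minimality at `α` then gives `‖u - ubar‖_1 = O(‖û - ubar‖_1)`
(`IsDiscrepancyChoice.exists_preimage`). As `‖u - udag‖_{-a} = O(δ)` by the discrepancy principle,
the interpolation inequality `‖w‖ ≤ C (γ ‖w‖_1 + γ ^ (-a) ‖w‖_{-a})` for `w = u - û` yields
`‖u - udag‖ = O(φ + γ ^ (-a) δ)` (`MainAssumption.exists_norm_sub_le`).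

The interpolation inequality rests on `G ^ (1 - q) (G ^ q x) = K G x` with `K > 0`
(`HasResolventBound.balakrishnan_balakrishnan`): after scaling one variable of the double integral
by the other and applying Fubini's theorem, the inner integral is a Frullani integral. This is the
only composition rule for fractional powers that is needed.

It remains to bound the low frequencies of `udag` and to choose `γ`. They tend to `0` on the closure
of the range of `G`, and are `O(γ ^ p)` on `X_p`. On the domain of `log G` they are
`O(1 / log (1 / γ))`: put `p = M / log (1 / γ)`, so that `γ ^ p = exp (-M)`. Then `G ^ p x - x` is
of size `p`, and for large `M` the low frequencies of `G ^ p x` are at most half of those of `x`, up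
to an error of size `p` (`HasResolventBound.exists_norm_lowPass_le_of_mem_logDomain`).
-/

namespace BanachScale

/-! ### Resolvents of an operator of positive type -/

section Resolvent

variable {X : Type*} [NormedAddCommGroup X] [NormedSpace ℝ X]

/-- The operator `(G + s I)⁻¹`; it has a junk value where `G + s I` is not invertible. -/
noncomputable def resolv (G : X →L[ℝ] X) (s : ℝ) : X →L[ℝ] X :=
  Ring.inverse (G + s • (1 : X →L[ℝ] X))

/-- The filter `s (G + s I)⁻¹`, which keeps the part of the spectrum of `G` below `s`. -/
noncomputable def lowPass (G : X →L[ℝ] X) (s : ℝ) : X →L[ℝ] X := s • resolv G s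

/-- The filter `G (G + s I)⁻¹ = I - s (G + s I)⁻¹`. -/
noncomputable def highPass (G : X →L[ℝ] X) (s : ℝ) : X →L[ℝ] X := G * resolv G s

/-- Positive type with an explicit constant, invertibility being stated in the algebra of bounded
operators. -/
def HasResolventBound (G : X →L[ℝ] X) (κ : ℝ) : Prop :=
  ∀ s : ℝ, 0 < s → IsUnit (G + s • (1 : X →L[ℝ] X)) ∧ ‖resolv G s‖ ≤ κ / s

theorem IsPositiveType.exists_hasResolventBound [CompleteSpace X] {G : X →L[ℝ] X}
    (h : IsPositiveType G) : ∃ κ : ℝ, 0 < κ ∧ HasResolventBound G κ := by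
  obtain ⟨κ, hκ, h⟩ := h
  exact ⟨κ, hκ, fun s hs =>
    ⟨ContinuousLinearMap.isUnit_iff_bijective.2 (h s hs).1, (h s hs).2⟩⟩

variable {G : X →L[ℝ] X} {κ s t : ℝ}

theorem commute_add_smul_one (G : X →L[ℝ] X) (s t : ℝ) :
    Commute (G + s • (1 : X →L[ℝ] X)) (G + t • (1 : X →L[ℝ] X)) := by
  have h1 : ∀ r : ℝ, Commute G (r • (1 : X →L[ℝ] X)) := fun r =>
    (Commute.one_right G).smul_right r
  exact ((Commute.refl G).add_right (h1 t)).add_left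
    ((h1 s).symm.add_right (((Commute.refl _).smul_right _).smul_left _))

theorem commute_resolv (G : X →L[ℝ] X) (s t : ℝ) : Commute (resolv G s) (resolv G t) :=
  (commute_add_smul_one G s t).ringInverse_ringInverse

namespace HasResolventBound

theorem mul_resolv (h : HasResolventBound G κ) (hs : 0 < s) :
    (G + s • (1 : X →L[ℝ] X)) * resolv G s = 1 :=
  Ring.mul_inverse_cancel _ (h s hs).1

theorem resolv_mul (h : HasResolventBound G κ) (hs : 0 < s) :
    resolv G s * (G + s • (1 : X →L[ℝ] X)) = 1 :=
  Ring.inverse_mul_cancel _ (h s hs).1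

theorem highPass_eq (h : HasResolventBound G κ) (hs : 0 < s) :
    highPass G s = 1 - lowPass G s := by
  have := h.mul_resolv hs
  rw [add_mul, smul_mul_assoc, one_mul] at this
  rw [highPass, lowPass, eq_sub_iff_add_eq, this]

theorem commute_generator (h : HasResolventBound G κ) (hs : 0 < s) :
    Commute G (resolv G s) := by
  have h1 := h.mul_resolv hs
  have h2 := h.resolv_mul hs
  rw [add_mul, smul_mul_assoc, one_mul] at h1
  rw [mul_add, mul_smul_comm, mul_one] at h2
  exact add_right_cancel (h1.trans h2.symm)

theorem commute_generator_lowPass (h : HasResolventBound G κ) (hs : 0 < s) :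
    Commute G (lowPass G s) :=
  (h.commute_generator hs).smul_right s

theorem norm_lowPass_le (h : HasResolventBound G κ) (hs : 0 < s) : ‖lowPass G s‖ ≤ κ := by
  rw [lowPass, norm_smul, Real.norm_of_nonneg hs.le]
  calc s * ‖resolv G s‖ ≤ s * (κ / s) := by gcongr; exact (h s hs).2
    _ = κ := by field_simp

theorem norm_highPass_le (h : HasResolventBound G κ) (hs : 0 < s) :
    ‖highPass G s‖ ≤ 1 + κ := by
  rw [h.highPass_eq hs]
  exact (norm_sub_le _ _).trans
    (add_le_add ContinuousLinearMap.norm_id_le (h.norm_lowPass_le hs))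

theorem norm_resolv_apply_le (h : HasResolventBound G κ) (hs : 0 < s) (x : X) :
    ‖resolv G s x‖ ≤ κ / s * ‖x‖ :=
  (resolv G s).le_of_opNorm_le (h s hs).2 x

theorem norm_lowPass_apply_le (h : HasResolventBound G κ) (hs : 0 < s) (x : X) :
    ‖lowPass G s x‖ ≤ κ * ‖x‖ :=
  (lowPass G s).le_of_opNorm_le (h.norm_lowPass_le hs) x

theorem norm_highPass_apply_le (h : HasResolventBound G κ) (hs : 0 < s) (x : X) :
    ‖highPass G s x‖ ≤ (1 + κ) * ‖x‖ :=
  (highPass G s).le_of_opNorm_le (h.norm_highPass_le hs) x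

theorem resolv_apply_generator (h : HasResolventBound G κ) (hs : 0 < s) (x : X) :
    resolv G s (G x) = highPass G s x := by
  have := congrArg (fun T : X →L[ℝ] X => T x) (h.commute_generator hs).eq
  exact this.symm

/-- The resolvent identity. -/
theorem sub_smul_resolv_mul (h : HasResolventBound G κ) (hs : 0 < s) (ht : 0 < t) :
    (t - s) • (resolv G t * resolv G s) = resolv G s - resolv G t := by
  have h1 : resolv G t * (((G + t • (1 : X →L[ℝ] X)) - (G + s • (1 : X →L[ℝ] X)))) * resolv G s
      = resolv G s - resolv G t := by
    rw [mul_sub, sub_mul, h.resolv_mul ht, one_mul, mul_assoc, h.mul_resolv hs, mul_one]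
  rw [← h1, add_sub_add_left_eq_sub, ← sub_smul, mul_smul_comm, mul_one, smul_mul_assoc]

theorem continuousOn_resolv [CompleteSpace X] (h : HasResolventBound G κ) :
    ContinuousOn (resolv G) (Ioi 0) := by
  intro s hs
  obtain ⟨u, hu⟩ := (h s hs).1
  have h1 : ContinuousAt Ring.inverse (G + s • (1 : X →L[ℝ] X)) :=
    hu ▸ NormedRing.inverse_continuousAt u
  have h2 : ContinuousAt (fun s : ℝ => G + s • (1 : X →L[ℝ] X)) s := by fun_prop
  exact (ContinuousAt.comp (f := fun s : ℝ => G + s • (1 : X →L[ℝ] X)) h1 h2).continuousWithinAt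

theorem continuousOn_highPass_apply [CompleteSpace X] (h : HasResolventBound G κ) (x : X) :
    ContinuousOn (fun s => highPass G s x) (Ioi 0) := by
  have := h.continuousOn_resolv
  unfold highPass
  exact (continuousOn_const.mul this).clm_apply continuousOn_const

end HasResolventBound

end Resolvent

/-! ### Integrals with a power weight -/

section PowerWeight

variable {E : Type*} [NormedAddCommGroup E] [NormedSpace ℝ E]

/-- A function bounded by `A` near `0` and by `B γ / s` near `∞` can be integrated against
`s ^ (q - 1)`. Splitting the integral at `γ` makes the bound proportional to `γ ^ q`. -/
theorem integrableOn_and_norm_integral_rpow_smul_le {f : ℝ → E} {q γ A B : ℝ} (hq : 0 < q)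
    (hq1 : q < 1) (hγ : 0 < γ) (hf : ContinuousOn f (Ioi 0)) (hA : ∀ s, 0 < s → ‖f s‖ ≤ A)
    (hB : ∀ s, 0 < s → ‖f s‖ ≤ B * γ / s) :
    IntegrableOn (fun s => s ^ (q - 1) • f s) (Ioi 0) ∧
      ‖∫ s in Ioi (0 : ℝ), s ^ (q - 1) • f s‖ ≤ γ ^ q * (A / q + B / (1 - q)) := by
  have hm : ContinuousOn (fun s : ℝ => s ^ (q - 1) • f s) (Ioi 0) :=
    (ContinuousOn.rpow_const continuousOn_id fun s hs => Or.inl (ne_of_gt hs)).smul hf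
  have hIoc : IntegrableOn (fun s : ℝ => s ^ (q - 1) * A) (Ioc 0 γ) :=
    ((intervalIntegral.intervalIntegrable_rpow' (a := 0) (b := γ)
      (by linarith : -1 < q - 1)).1).mul_const A
  have hIoi : IntegrableOn (fun s : ℝ => s ^ (q - 2) * (B * γ)) (Ioi γ) :=
    (integrableOn_Ioi_rpow_of_lt (by linarith) hγ).mul_const _
  have b1 : ∀ s ∈ Ioc 0 γ, ‖s ^ (q - 1) • f s‖ ≤ s ^ (q - 1) * A := by
    intro s hs
    have := Real.rpow_nonneg hs.1.le (q - 1)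
    rw [norm_smul, Real.norm_of_nonneg this]
    exact mul_le_mul_of_nonneg_left (hA s hs.1) this
  have b2 : ∀ s ∈ Ioi γ, ‖s ^ (q - 1) • f s‖ ≤ s ^ (q - 2) * (B * γ) := by
    intro s hs
    have hs0 : 0 < s := hγ.trans hs
    have := Real.rpow_nonneg hs0.le (q - 1)
    rw [norm_smul, Real.norm_of_nonneg this]
    calc s ^ (q - 1) * ‖f s‖ ≤ s ^ (q - 1) * (B * γ / s) :=
          mul_le_mul_of_nonneg_left (hB s hs0) this
      _ = s ^ (q - 2) * (B * γ) := by
          rw [show q - 1 = (q - 2) + 1 by ring, Real.rpow_add_one hs0.ne']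
          field_simp
  have i1 : IntegrableOn (fun s => s ^ (q - 1) • f s) (Ioc 0 γ) :=
    hIoc.mono' ((hm.mono fun s hs => hs.1).aestronglyMeasurable measurableSet_Ioc)
      ((ae_restrict_iff' measurableSet_Ioc).2 (Eventually.of_forall b1))
  have i2 : IntegrableOn (fun s => s ^ (q - 1) • f s) (Ioi γ) :=
    hIoi.mono' ((hm.mono fun s hs => hγ.trans hs).aestronglyMeasurable measurableSet_Ioi)
      ((ae_restrict_iff' measurableSet_Ioi).2 (Eventually.of_forall b2))
  have hu : Ioc 0 γ ∪ Ioi γ = Ioi (0 : ℝ) := Ioc_union_Ioi_eq_Ioi hγ.le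
  refine ⟨hu ▸ i1.union i2, ?_⟩
  rw [← hu, setIntegral_union (Ioc_disjoint_Ioi le_rfl) measurableSet_Ioi i1 i2]
  have n1 : ‖∫ s in Ioc 0 γ, s ^ (q - 1) • f s‖ ≤ γ ^ q * (A / q) := by
    refine (norm_integral_le_of_norm_le hIoc
      ((ae_restrict_iff' measurableSet_Ioc).2 (Eventually.of_forall b1))).trans_eq ?_
    rw [integral_mul_const, ← intervalIntegral.integral_of_le hγ.le,
      integral_rpow (Or.inl (by linarith)), sub_add_cancel, Real.zero_rpow hq.ne']
    ring
  have n2 : ‖∫ s in Ioi γ, s ^ (q - 1) • f s‖ ≤ γ ^ q * (B / (1 - q)) := by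
    refine (norm_integral_le_of_norm_le hIoi
      ((ae_restrict_iff' measurableSet_Ioi).2 (Eventually.of_forall b2))).trans_eq ?_
    have e : γ ^ q = γ ^ (q - 2 + 1) * γ := by
      rw [← Real.rpow_add_one hγ.ne']
      congr 1
      ring
    rw [integral_mul_const, integral_Ioi_rpow_of_lt (by linarith) hγ, e]
    generalize γ ^ (q - 2 + 1) = z
    have : 1 - q ≠ 0 := by linarith
    rw [show q - 2 + 1 = -(1 - q) by ring]
    field_simp
  linarith [norm_add_le (∫ s in Ioc 0 γ, s ^ (q - 1) • f s) (∫ s in Ioi γ, s ^ (q - 1) • f s)]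

end PowerWeight

/-! ### The Balakrishnan integral -/

section Balakrishnan

variable {X : Type*} [NormedAddCommGroup X] [NormedSpace ℝ X] {G : X →L[ℝ] X} {κ q s t γ : ℝ}

namespace HasResolventBound

theorem commute_highPass (h : HasResolventBound G κ) (hs : 0 < s) (ht : 0 < t) :
    Commute (highPass G s) (highPass G t) :=
  ((Commute.refl G).mul_right (h.commute_generator ht)).mul_left
    ((h.commute_generator hs).symm.mul_right (commute_resolv G s t))

theorem commute_lowPass_highPass (h : HasResolventBound G κ) (ht : 0 < t) (hs : 0 < s) :
    Commute (lowPass G t) (highPass G s) := by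
  have := h.commute_highPass ht hs
  rw [h.highPass_eq ht] at this
  simpa using (Commute.one_left (highPass G s)).sub_left this

theorem norm_highPass_apply_le_div (h : HasResolventBound G κ) (hs : 0 < s) (x : X) :
    ‖highPass G s x‖ ≤ κ * ‖G x‖ / s := by
  rw [← h.resolv_apply_generator hs]
  exact (h.norm_resolv_apply_le hs _).trans_eq (by ring)

theorem balakrishnan_eq (h : HasResolventBound G κ) (q : ℝ) (x : X) :
    balakrishnan G q x =
      (Real.sin (Real.pi * q) / Real.pi) • ∫ s in Ioi (0 : ℝ), s ^ (q - 1) • highPass G s x := by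
  rw [balakrishnan]
  congr 1
  refine setIntegral_congr_fun measurableSet_Ioi fun s hs => ?_
  exact congrArg _ (h.resolv_apply_generator hs x)

variable [CompleteSpace X]

theorem integrableOn_rpow_smul_highPass (h : HasResolventBound G κ) (hq : 0 < q) (hq1 : q < 1)
    (x : X) : IntegrableOn (fun s => s ^ (q - 1) • highPass G s x) (Ioi 0) :=
  (integrableOn_and_norm_integral_rpow_smul_le hq hq1 one_pos (h.continuousOn_highPass_apply x)
    (fun _ hs => h.norm_highPass_apply_le hs x)
    (fun s hs => (h.norm_highPass_apply_le_div hs x).trans_eq (by rw [mul_one]))).1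

theorem balakrishnan_sub (h : HasResolventBound G κ) (hq : 0 < q) (hq1 : q < 1) (x y : X) :
    balakrishnan G q (x - y) = balakrishnan G q x - balakrishnan G q y := by
  simp only [h.balakrishnan_eq, map_sub, smul_sub]
  rw [integral_sub (h.integrableOn_rpow_smul_highPass hq hq1 x)
    (h.integrableOn_rpow_smul_highPass hq hq1 y), smul_sub]

/-- A bounded operator can be moved under the Balakrishnan integral. -/
theorem apply_balakrishnan (h : HasResolventBound G κ) (hq : 0 < q) (hq1 : q < 1)
    (T : X →L[ℝ] X) (x : X) :
    T (balakrishnan G q x) = (Real.sin (Real.pi * q) / Real.pi) •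
      ∫ s in Ioi (0 : ℝ), s ^ (q - 1) • T (highPass G s x) := by
  rw [h.balakrishnan_eq, map_smul,
    ← T.integral_comp_comm (h.integrableOn_rpow_smul_highPass hq hq1 x)]
  simp only [map_smul]

theorem apply_balakrishnan_of_commute (h : HasResolventBound G κ) (hq : 0 < q) (hq1 : q < 1)
    {T : X →L[ℝ] X} (hT : ∀ s, 0 < s → Commute T (highPass G s)) (x : X) :
    T (balakrishnan G q x) = balakrishnan G q (T x) := by
  rw [h.apply_balakrishnan hq hq1, h.balakrishnan_eq]
  congr 1
  refine setIntegral_congr_fun measurableSet_Ioi fun s hs => ?_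
  exact congrArg (fun S : X →L[ℝ] X => s ^ (q - 1) • S x) (hT s hs).eq

theorem sin_div_pi_pos (hq : 0 < q) (hq1 : q < 1) : 0 < Real.sin (Real.pi * q) / Real.pi :=
  div_pos (Real.sin_pos_of_pos_of_lt_pi (mul_pos Real.pi_pos hq)
    (by nlinarith [Real.pi_pos])) Real.pi_pos

/-- The low frequencies of `G ^ q x` are of size `γ ^ q`. The low frequencies of `x` itself enter
with the weight `1 / q`, the whole of `x` with a weight that stays bounded as `q → 0`; the common
factor `sin (π q) / π` is of size `q`. -/
theorem norm_lowPass_balakrishnan_le (h : HasResolventBound G κ) (hκ : 0 < κ) (hq : 0 < q)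
    (hq1 : q < 1) (hγ : 0 < γ) (x : X) :
    ‖lowPass G γ (balakrishnan G q x)‖ ≤ Real.sin (Real.pi * q) / Real.pi *
      (γ ^ q * ((1 + κ) * ‖lowPass G γ x‖ / q + κ * (1 + κ) * ‖x‖ / (1 - q))) := by
  rw [h.apply_balakrishnan hq hq1, norm_smul, Real.norm_of_nonneg (sin_div_pi_pos hq hq1).le]
  refine mul_le_mul_of_nonneg_left ?_ (sin_div_pi_pos hq hq1).le
  refine (integrableOn_and_norm_integral_rpow_smul_le hq hq1 hγ
    ((lowPass G γ).continuous.comp_continuousOn (h.continuousOn_highPass_apply x)) ?_ ?_).2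
  · intro s hs
    have := congrArg (fun S : X →L[ℝ] X => S x) (h.commute_lowPass_highPass hγ hs).eq
    simp only [mul_apply_eq_comp] at this
    exact (congrArg norm this).trans_le (h.norm_highPass_apply_le hs _)
  · intro s hs
    have e : lowPass G γ (highPass G s x) = (γ / s) • highPass G γ (lowPass G s x) := by
      have : resolv G γ (G (resolv G s x)) = highPass G γ (resolv G s x) :=
        h.resolv_apply_generator hγ _
      simp only [lowPass, smul_apply, map_smul, smul_smul]
      rw [div_mul_cancel₀ _ hs.ne', ← this]
      rfl
    rw [Function.comp_apply, e, norm_smul, Real.norm_of_nonneg (by positivity)]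
    calc γ / s * ‖highPass G γ (lowPass G s x)‖
        ≤ γ / s * ((1 + κ) * (κ * ‖x‖)) := by
          gcongr
          exact (h.norm_highPass_apply_le hγ _).trans
            (mul_le_mul_of_nonneg_left (h.norm_lowPass_apply_le hs x) (by positivity))
      _ = κ * (1 + κ) * ‖x‖ * γ / s := by ring

theorem exists_norm_lowPass_balakrishnan_le (h : HasResolventBound G κ) (hκ : 0 < κ) (hq : 0 < q)
    (hq1 : q < 1) : ∃ C : ℝ, 0 < C ∧ ∀ γ : ℝ, 0 < γ → ∀ x : X,
      ‖lowPass G γ (balakrishnan G q x)‖ ≤ C * γ ^ q * ‖x‖ := by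
  have hc := sin_div_pi_pos hq hq1
  have : 0 < 1 - q := by linarith
  refine ⟨Real.sin (Real.pi * q) / Real.pi * (κ * (1 + κ) / q + κ * (1 + κ) / (1 - q)),
    by positivity, fun γ hγ x => ?_⟩
  refine (h.norm_lowPass_balakrishnan_le hκ hq hq1 hγ x).trans ?_
  calc _ ≤ Real.sin (Real.pi * q) / Real.pi *
      (γ ^ q * ((1 + κ) * (κ * ‖x‖) / q + κ * (1 + κ) * ‖x‖ / (1 - q))) := by
        gcongr
        exact h.norm_lowPass_apply_le hγ x
    _ = _ := by ring

end HasResolventBound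

end Balakrishnan

/-! ### Complementary fractional powers -/

section Complementary

variable {X : Type*} [NormedAddCommGroup X] [NormedSpace ℝ X] {G : X →L[ℝ] X} {κ q s t γ : ℝ}

/-- The constant in `G ^ (1 - q) (G ^ q x) = K G x`, before normalization. Its value
`(π / sin (π q)) ^ 2` is not needed, only its sign. The junk value of the integrand at `l = 1` is
irrelevant. -/
noncomputable def complementaryConst (q : ℝ) : ℝ :=
  ∫ l in Ioi (0 : ℝ), l ^ (q - 1) * (Real.log l / (l - 1))

theorem log_div_sub_one_pos {l : ℝ} (hl : 0 < l) (h1 : l ≠ 1) : 0 < Real.log l / (l - 1) := by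
  rcases lt_or_gt_of_ne h1 with h | h
  · exact div_pos_of_neg_of_neg (Real.log_neg hl h) (by linarith)
  · exact div_pos (Real.log_pos h) (by linarith)

variable [CompleteSpace X]

/-- The kernel that appears in `G ^ (1 - q) (G ^ q x)` when the inner variable is scaled by the
outer one. -/
theorem HasResolventBound.integrable_complementary_kernel (h : HasResolventBound G κ)
    (hκ : 0 < κ) (hq : 0 < q) (hq1 : q < 1) (x : X) :
    Integrable (Function.uncurry fun t l : ℝ =>
      l ^ (q - 1) • highPass G t (highPass G (l * t) x))
      ((volume.restrict (Ioi (0 : ℝ))).prod (volume.restrict (Ioi (0 : ℝ)))) := by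
  -- For fixed `t` the filters commute, and `‖G (G + l t I)⁻¹ y‖ = O(min 1 (1 / (l t)))` with
  -- `y = G (G + t I)⁻¹ x`; splitting the `l`-integral at `1 / t` leaves an integrable weight in `t`.
  have key : ∀ t : ℝ, 0 < t →
      IntegrableOn (fun l => l ^ (q - 1) • highPass G t (highPass G (l * t) x)) (Ioi 0) ∧
      ∫ l in Ioi (0 : ℝ), ‖l ^ (q - 1) • highPass G t (highPass G (l * t) x)‖ ≤
        t ^ ((1 - q) - 1) * ((1 + κ) * ‖highPass G t x‖ / q +
          κ * ‖highPass G t (G x)‖ / (1 - q)) := by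
    intro t ht
    have comm : ∀ l : ℝ, 0 < l → highPass G t (highPass G (l * t) x) =
        highPass G (l * t) (highPass G t x) := fun l hl =>
      congrArg (fun S : X →L[ℝ] X => S x) (h.commute_highPass ht (mul_pos hl ht)).eq
    have hGt : G (highPass G t x) = highPass G t (G x) :=
      congrArg (fun S : X →L[ℝ] X => S x)
        ((Commute.refl G).mul_right (h.commute_generator ht)).eq
    have hcont : ContinuousOn (fun l => highPass G t (highPass G (l * t) x)) (Ioi 0) :=
      (highPass G t).continuous.comp_continuousOn
        ((h.continuousOn_highPass_apply x).comp (by fun_prop)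
          fun l (hl : 0 < l) => mul_pos hl ht)
    have hA : ∀ l, 0 < l → ‖highPass G t (highPass G (l * t) x)‖ ≤
        (1 + κ) * ‖highPass G t x‖ := fun l hl => by
      rw [comm l hl]; exact h.norm_highPass_apply_le (mul_pos hl ht) _
    have hB : ∀ l, 0 < l → ‖highPass G t (highPass G (l * t) x)‖ ≤
        κ * ‖highPass G t (G x)‖ * t⁻¹ / l := fun l hl => by
      rw [comm l hl]
      refine (h.norm_highPass_apply_le_div (mul_pos hl ht) _).trans_eq ?_
      rw [hGt]; field_simp
    refine ⟨(integrableOn_and_norm_integral_rpow_smul_le hq hq1 (inv_pos.2 ht) hcont hA hB).1, ?_⟩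
    have := (integrableOn_and_norm_integral_rpow_smul_le (E := ℝ) hq hq1 (inv_pos.2 ht) hcont.norm
      (fun l hl => by rw [norm_norm]; exact hA l hl)
      (fun l hl => by rw [norm_norm]; exact hB l hl)).2
    rw [sub_sub_cancel_left, Real.rpow_neg ht.le, ← Real.inv_rpow ht.le]
    refine le_trans (le_of_eq ?_) ((Real.le_norm_self _).trans this)
    refine setIntegral_congr_fun measurableSet_Ioi fun l (hl : 0 < l) => ?_
    simp only [norm_smul, smul_eq_mul]
    rw [Real.norm_of_nonneg (Real.rpow_nonneg hl.le _)]
  have hmeas : AEStronglyMeasurable (Function.uncurry fun t l : ℝ =>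
      l ^ (q - 1) • highPass G t (highPass G (l * t) x))
      ((volume.restrict (Ioi (0 : ℝ))).prod (volume.restrict (Ioi (0 : ℝ)))) := by
    rw [Measure.prod_restrict]
    refine ContinuousOn.aestronglyMeasurable ?_ (measurableSet_Ioi.prod measurableSet_Ioi)
    have c1 : ContinuousOn (fun z : ℝ × ℝ => highPass G z.1) (Ioi 0 ×ˢ Ioi 0) :=
      continuousOn_const.mul (h.continuousOn_resolv.comp continuousOn_fst fun z hz => hz.1)
    have c2 : ContinuousOn (fun z : ℝ × ℝ => highPass G (z.2 * z.1) x) (Ioi 0 ×ˢ Ioi 0) :=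
      (h.continuousOn_highPass_apply x).comp (by fun_prop) 
        fun z (hz : 0 < z.1 ∧ 0 < z.2) => mul_pos hz.2 hz.1
    exact (ContinuousOn.rpow_const continuousOn_snd fun z hz => Or.inl (ne_of_gt hz.2)).smul
      (c1.clm_apply c2)
  rw [integrable_prod_iff hmeas]
  refine ⟨(ae_restrict_iff' measurableSet_Ioi).2 (Eventually.of_forall fun t ht => (key t ht).1),
    ?_⟩
  have hint : ∀ y : X, IntegrableOn (fun t => t ^ ((1 - q) - 1) * ‖highPass G t y‖) (Ioi 0) :=
    fun y => (integrableOn_and_norm_integral_rpow_smul_le (E := ℝ) (by linarith : 0 < 1 - q)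
      (by linarith) one_pos (h.continuousOn_highPass_apply y).norm
      (fun s hs => by rw [norm_norm]; exact h.norm_highPass_apply_le hs y)
      (fun s hs => by
        rw [norm_norm, mul_one]; exact h.norm_highPass_apply_le_div hs y)).1
  refine (((hint x).const_mul ((1 + κ) / q)).add ((hint (G x)).const_mul (κ / (1 - q)))).mono'
    hmeas.norm.integral_prod_right' ?_
  refine (ae_restrict_iff' measurableSet_Ioi).2 (Eventually.of_forall fun t ht => ?_)
  rw [Real.norm_of_nonneg (integral_nonneg fun _ => norm_nonneg _)]
  refine (key t ht).2.trans_eq ?_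
  simp only [Pi.add_apply]
  ring

/-- The inner integral is of Frullani type: by the resolvent identity the integrand is
`t⁻¹ (f t - f (l t)) / (l - 1)` with `f t = G (G + t I)⁻¹ G x`, and `f` runs from `G x` to `0`. -/
theorem HasResolventBound.integral_highPass_highPass (h : HasResolventBound G κ) {l : ℝ}
    (hl : 0 < l) (hl1 : l ≠ 1) (x : X)
    (hint : IntegrableOn (fun t => highPass G t (highPass G (l * t) x)) (Ioi 0)) :
    ∫ t in Ioi (0 : ℝ), highPass G t (highPass G (l * t) x) =
      (Real.log l / (l - 1)) • G x := by
  have hl1' : l - 1 ≠ 0 := sub_ne_zero.2 hl1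
  have e : ∀ t ∈ Ioi (0 : ℝ), t⁻¹ • (highPass G (1 * t) (G x) - highPass G (l * t) (G x)) =
      (l - 1) • highPass G t (highPass G (l * t) x) := by
    intro t ht
    have ht' : (0 : ℝ) < t := ht
    have e0 := h.sub_smul_resolv_mul ht' (mul_pos hl ht')
    have e1 : highPass G t (highPass G (l * t) x) =
        G ((resolv G (l * t) * resolv G t) (G x)) := by
      rw [← (commute_resolv G t (l * t)).eq, ← h.resolv_apply_generator (mul_pos hl ht') x]
      rfl
    rw [e1, ← map_smul, ← smul_apply, one_mul,
      show l - 1 = t⁻¹ * (l * t - t) by field_simp, mul_smul, e0]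
    simp [highPass]
  have hcont := h.continuousOn_highPass_apply (G x)
  have hR : Tendsto (fun t => highPass G t (G x)) atTop (𝓝 0) := by
    refine squeeze_zero_norm' (a := fun t => κ * ‖G (G x)‖ / t) ?_ ?_
    · filter_upwards [eventually_gt_atTop 0] with t ht
      exact h.norm_highPass_apply_le_div ht _
    · exact tendsto_const_nhds.div_atTop tendsto_id
  have hL : Tendsto (fun t => highPass G t (G x)) (𝓝[>] 0) (𝓝 (G x)) := by
    have : Tendsto (fun t => lowPass G t (G x)) (𝓝[>] 0) (𝓝 0) := by
      refine squeeze_zero_norm' (a := fun t => t * ((1 + κ) * ‖x‖)) ?_ ?_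
      · filter_upwards [self_mem_nhdsWithin] with t (ht : 0 < t)
        rw [lowPass, smul_apply, h.resolv_apply_generator ht, norm_smul,
          Real.norm_of_nonneg ht.le]
        exact mul_le_mul_of_nonneg_left (h.norm_highPass_apply_le ht _) ht.le
      · have : Tendsto (fun t : ℝ => t * ((1 + κ) * ‖x‖)) (𝓝 0) (𝓝 (0 * ((1 + κ) * ‖x‖))) :=
          tendsto_id.mul_const _
        rw [zero_mul] at this
        exact this.mono_left nhdsWithin_le_nhds
    have h2 := (tendsto_const_nhds (x := G x)).sub this
    rw [sub_zero] at h2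
    refine h2.congr' ?_
    filter_upwards [self_mem_nhdsWithin] with t (ht : 0 < t)
    rw [h.highPass_eq ht]
    rfl
  have hfr := Frullani.integral_Ioi_eq (f := fun t => highPass G t (G x))
    (hcont.locallyIntegrableOn measurableSet_Ioi) one_pos hl hL hR
    (IntegrableOn.congr_fun (hint.smul (l - 1)) (fun t ht => (e t ht).symm) measurableSet_Ioi)
  rw [setIntegral_congr_fun measurableSet_Ioi e, integral_smul, div_one, sub_zero] at hfr
  rw [div_eq_inv_mul, mul_smul, ← hfr, smul_smul, inv_mul_cancel₀ hl1', one_smul]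

theorem HasResolventBound.ae_integral_complementary_kernel (h : HasResolventBound G κ)
    (hκ : 0 < κ) (hq : 0 < q) (hq1 : q < 1) (x : X) :
    ∀ᵐ l ∂(volume.restrict (Ioi (0 : ℝ))),
      ∫ t in Ioi (0 : ℝ), l ^ (q - 1) • highPass G t (highPass G (l * t) x) =
        (l ^ (q - 1) * (Real.log l / (l - 1))) • G x := by
  have hne : ∀ᵐ l : ℝ ∂(volume.restrict (Ioi (0 : ℝ))), l ≠ 1 :=
    Measure.ae_ne _ _
  filter_upwards [(h.integrable_complementary_kernel hκ hq hq1 x).prod_left_ae, hne,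
    ae_restrict_mem measurableSet_Ioi] with l hint hl1 (hl : 0 < l)
  have hpos := Real.rpow_pos_of_pos hl (q - 1)
  rw [integral_smul, h.integral_highPass_highPass hl hl1 x, smul_smul]
  exact (integrable_smul_iff hpos.ne' _).1 hint

theorem HasResolventBound.balakrishnan_balakrishnan (h : HasResolventBound G κ)
    (hκ : 0 < κ) (hq : 0 < q) (hq1 : q < 1) (x : X) :
    balakrishnan G (1 - q) (balakrishnan G q x) =
      ((Real.sin (Real.pi * q) / Real.pi) ^ 2 * complementaryConst q) • G x := by
  -- The substitution `s = l t` in the inner integral cancels the weight in `t`.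
  have hin : ∀ t ∈ Ioi (0 : ℝ), t ^ ((1 - q) - 1) • highPass G t (balakrishnan G q x) =
      (Real.sin (Real.pi * q) / Real.pi) •
        ∫ l in Ioi (0 : ℝ), l ^ (q - 1) • highPass G t (highPass G (l * t) x) := by
    intro t (ht : 0 < t)
    rw [h.apply_balakrishnan hq hq1, smul_comm]
    congr 1
    have := integral_comp_mul_left_Ioi' (fun s => s ^ (q - 1) • highPass G t (highPass G s x)) 0 ht
    rw [mul_zero] at this
    rw [← this, smul_smul, ← integral_smul]
    refine setIntegral_congr_fun measurableSet_Ioi fun l (hl : 0 < l) => ?_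
    simp only [smul_smul]
    rw [mul_comm t l, Real.mul_rpow hl.le ht.le]
    congr 1
    rw [show t ^ (1 - q - 1) * t * (l ^ (q - 1) * t ^ (q - 1)) =
      l ^ (q - 1) * (t ^ (1 - q - 1) * t ^ (q - 1) * t) by ring, ← Real.rpow_add ht,
      ← Real.rpow_add_one ht.ne', show 1 - q - 1 + (q - 1) + 1 = 0 by ring, Real.rpow_zero, mul_one]
  rw [h.balakrishnan_eq (1 - q), setIntegral_congr_fun measurableSet_Ioi hin, integral_smul,
    integral_integral_swap (h.integrable_complementary_kernel hκ hq hq1 x),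
    integral_congr_ae (h.ae_integral_complementary_kernel hκ hq hq1 x), integral_smul_const,
    ← complementaryConst, smul_smul, smul_smul, mul_sub, mul_one, Real.sin_pi_sub]
  congr 1
  ring

theorem HasResolventBound.complementaryConst_pos (h : HasResolventBound G κ)
    (hκ : 0 < κ) (hq : 0 < q) (hq1 : q < 1) {x : X} (hx : G x ≠ 0) :
    0 < complementaryConst q := by
  have hint : IntegrableOn (fun l : ℝ => l ^ (q - 1) * (Real.log l / (l - 1))) (Ioi 0) := by
    refine (integrable_smul_const hx).1 (Integrable.congr ?_
      (h.ae_integral_complementary_kernel hκ hq hq1 x))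
    exact (h.integrable_complementary_kernel hκ hq hq1 x).integral_prod_right
  have hne : ∀ᵐ l : ℝ ∂(volume.restrict (Ioi (0 : ℝ))), l ≠ 1 := Measure.ae_ne _ _
  have hpos : ∀ᵐ l : ℝ ∂(volume.restrict (Ioi (0 : ℝ))),
      0 < l ^ (q - 1) * (Real.log l / (l - 1)) := by
    filter_upwards [hne, ae_restrict_mem measurableSet_Ioi] with l hl1 (hl : 0 < l)
    exact mul_pos (Real.rpow_pos_of_pos hl _) (log_div_sub_one_pos hl hl1)
  have h0 : 0 ≤ᵐ[volume.restrict (Ioi (0 : ℝ))]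
      fun l : ℝ => l ^ (q - 1) * (Real.log l / (l - 1)) := hpos.mono fun _ hl => hl.le
  refine lt_of_le_of_ne (integral_nonneg_of_ae h0) fun h1 => ?_
  have h2 := (integral_eq_zero_iff_of_nonneg_ae h0 hint).1 h1.symm
  have h3 : ∀ᵐ _ : ℝ ∂(volume.restrict (Ioi (0 : ℝ))), False := by
    filter_upwards [h2, hpos] with l e1 e2
    exact e2.ne' e1
  rw [eventually_false_iff_eq_bot, ae_eq_bot, Measure.restrict_eq_zero] at h3
  simp at h3

/-- `G x` is controlled at high frequencies by `G ^ q x`, with the power of the cut-off frequency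
that the missing factor `G ^ (1 - q)` suggests. -/
theorem HasResolventBound.exists_norm_highPass_le_balakrishnan (h : HasResolventBound G κ)
    (hκ : 0 < κ) (hq : 0 < q) (hq1 : q < 1) :
    ∃ C : ℝ, 0 < C ∧ ∀ γ : ℝ, 0 < γ → ∀ x : X,
      ‖highPass G γ x‖ ≤ C * γ ^ (-q) * ‖balakrishnan G q x‖ := by
  obtain ⟨C, hC, hle⟩ := h.exists_norm_lowPass_balakrishnan_le hκ
    (by linarith : 0 < 1 - q) (by linarith)
  set c := (Real.sin (Real.pi * q) / Real.pi) ^ 2 with hc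
  have hcpos : 0 < c := pow_pos (sin_div_pi_pos hq hq1) 2
  -- The sign of the constant is read off from a nonzero value of `G`.
  by_cases h0 : ∀ x, G x = 0
  · refine ⟨1, one_pos, fun γ hγ x => ?_⟩
    rw [highPass, mul_apply_eq_comp, h0, norm_zero]
    positivity
  push Not at h0
  obtain ⟨x₀, hx₀⟩ := h0
  have hK := h.complementaryConst_pos hκ hq hq1 hx₀
  have hcK := mul_pos hcpos hK
  refine ⟨(c * complementaryConst q)⁻¹ * C, by positivity, fun γ hγ x => ?_⟩
  have e : highPass G γ x = ((c * complementaryConst q)⁻¹ * γ⁻¹) •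
      lowPass G γ (balakrishnan G (1 - q) (balakrishnan G q x)) := by
    rw [h.balakrishnan_balakrishnan hκ hq hq1, ← hc, map_smul, lowPass,
      smul_apply, h.resolv_apply_generator hγ, smul_smul, smul_smul]
    rw [show (c * complementaryConst q)⁻¹ * γ⁻¹ * (c * complementaryConst q) * γ = 1 by
      field_simp, one_smul]
  rw [e, norm_smul, Real.norm_of_nonneg (by positivity)]
  calc _ ≤ ((c * complementaryConst q)⁻¹ * γ⁻¹) * (C * γ ^ (1 - q) * ‖balakrishnan G q x‖) := by
        gcongr
        exact hle γ hγ _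
    _ = _ := by
        rw [show 1 - q = -q + 1 by ring, Real.rpow_add_one hγ.ne']
        field_simp

end Complementary

/-! ### Filters and the norms of the scale -/

section ScaleEstimates

variable {X : Type*} [NormedAddCommGroup X] [NormedSpace ℝ X] {G : X →L[ℝ] X} {κ a γ : ℝ}

theorem norm_pow_apply_le {T : X →L[ℝ] X} {c : ℝ} (hc : 0 ≤ c) (hT : ∀ x, ‖T x‖ ≤ c * ‖x‖)
    (n : ℕ) (x : X) : ‖(T ^ n) x‖ ≤ c ^ n * ‖x‖ := by
  induction n with
  | zero => simp
  | succ n ih =>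
    rw [pow_succ', mul_apply_eq_comp]
    calc _ ≤ c * (c ^ n * ‖x‖) := (hT _).trans (mul_le_mul_of_nonneg_left ih hc)
      _ = _ := by ring

theorem natFloor_add_fract (ha : 0 ≤ a) : (⌊a⌋₊ : ℝ) + Int.fract a = a := by
  rw [natCast_floor_eq_intCast_floor ha, Int.floor_add_fract]

theorem fracPow_one (x : X) : fracPow G 1 x = G x := by
  simp [fracPow]

theorem fracPow_of_mem_Ioo {p : ℝ} (hp : 0 < p) (hp1 : p < 1) (x : X) :
    fracPow G p x = balakrishnan G p x := by
  have hf : Int.fract p = p := Int.fract_eq_self.2 ⟨hp.le, hp1⟩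
  have hfl : ⌊p⌋₊ = 0 := Nat.floor_eq_zero.2 hp1
  rw [fracPow, hf, hfl, if_neg hp.ne', pow_zero]
  rfl

namespace HasResolventBound

theorem lowPass_apply_generator (h : HasResolventBound G κ) (hγ : 0 < γ) (x : X) :
    lowPass G γ (G x) = γ • highPass G γ x := by
  rw [lowPass, smul_apply, h.resolv_apply_generator hγ]

theorem norm_lowPass_generator_le (h : HasResolventBound G κ) (hγ : 0 < γ) (x : X) :
    ‖lowPass G γ (G x)‖ ≤ γ * ((1 + κ) * ‖x‖) := by
  rw [h.lowPass_apply_generator hγ, norm_smul, Real.norm_of_nonneg hγ.le]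
  exact mul_le_mul_of_nonneg_left (h.norm_highPass_apply_le hγ x) hγ.le

/-- The part removed by an iterated low-pass filter lies in the range of `G`. Its preimage is
bounded by the low frequencies alone. -/
theorem exists_sub_lowPass_pow (h : HasResolventBound G κ) (hκ : 0 < κ) (m : ℕ) :
    ∃ C : ℝ, 0 ≤ C ∧ ∀ γ : ℝ, 0 < γ → ∀ x : X, ∃ v : X,
      x - (lowPass G γ ^ m) x = G v ∧ ‖v‖ ≤ C * (‖lowPass G γ x‖ / γ) := by
  refine ⟨∑ k ∈ Finset.range m, κ ^ k, Finset.sum_nonneg fun k _ => by positivity,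
    fun γ hγ x => ⟨γ⁻¹ • (∑ k ∈ Finset.range m, lowPass G γ ^ k) (lowPass G γ x), ?_, ?_⟩⟩
  · have e : (1 : X →L[ℝ] X) - lowPass G γ ^ m =
        G * (γ⁻¹ • ((∑ k ∈ Finset.range m, lowPass G γ ^ k) * lowPass G γ)) := by
      have comm : Commute (lowPass G γ) (∑ k ∈ Finset.range m, lowPass G γ ^ k) :=
        Commute.sum_right _ _ _ fun k _ => (Commute.refl _).pow_right k
      rw [← mul_neg_geom_sum, ← h.highPass_eq hγ, ← comm.eq, ← smul_mul_assoc, ← mul_assoc,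
        highPass]
      congr 2
      rw [lowPass, smul_smul, inv_mul_cancel₀ hγ.ne', one_smul]
    exact congrArg (fun T : X →L[ℝ] X => T x) e
  · rw [norm_smul, norm_inv, Real.norm_of_nonneg hγ.le, sum_apply]
    calc γ⁻¹ * ‖∑ k ∈ Finset.range m, (lowPass G γ ^ k) (lowPass G γ x)‖
        ≤ γ⁻¹ * ∑ k ∈ Finset.range m, κ ^ k * ‖lowPass G γ x‖ := by
          gcongr
          exact norm_sum_le_of_le _ fun k _ =>
            norm_pow_apply_le hκ.le (h.norm_lowPass_apply_le hγ) k _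
      _ = _ := by rw [← Finset.sum_mul]; ring

theorem generator_pow_lowPass_pow (h : HasResolventBound G κ) (hγ : 0 < γ) (n : ℕ) (x : X) :
    (G ^ n) ((lowPass G γ ^ n) x) = γ ^ n • (highPass G γ ^ n) x := by
  have e : G * lowPass G γ = γ • highPass G γ := by rw [lowPass, mul_smul_comm, highPass]
  have := (h.commute_generator_lowPass hγ).mul_pow n
  rw [e, smul_pow] at this
  exact (congrArg (fun T : X →L[ℝ] X => T x) this).symm

variable [CompleteSpace X]

theorem fracPow_sub (h : HasResolventBound G κ) (x y : X) :
    fracPow G a (x - y) = fracPow G a x - fracPow G a y := by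
  by_cases hf : Int.fract a = 0
  · simp only [fracPow, hf, if_true, map_sub]
  · simp only [fracPow, hf, if_false, map_sub]
    exact h.balakrishnan_sub (lt_of_le_of_ne (Int.fract_nonneg a) (Ne.symm hf))
      (Int.fract_lt_one a) _ _

/-- The low frequencies are small in the weak norm `‖·‖_{-a}`. -/
theorem exists_norm_fracPow_lowPass_pow_le (h : HasResolventBound G κ) (hκ : 0 < κ)
    (ha : 0 ≤ a) : ∃ C : ℝ, 0 < C ∧ ∀ γ : ℝ, 0 < γ → ∀ x : X,
      ‖fracPow G a ((lowPass G γ ^ (⌊a⌋₊ + 1)) x)‖ ≤ C * γ ^ a * ‖x‖ := by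
  have hP : ∀ γ : ℝ, 0 < γ → ∀ (n : ℕ) (x : X),
      ‖(highPass G γ ^ n) x‖ ≤ (1 + κ) ^ n * ‖x‖ := fun γ hγ =>
    norm_pow_apply_le (by linarith) (h.norm_highPass_apply_le hγ)
  by_cases hf : Int.fract a = 0
  · refine ⟨(1 + κ) ^ ⌊a⌋₊ * κ, by positivity, fun γ hγ x => ?_⟩
    have hγa : γ ^ a = γ ^ ⌊a⌋₊ := by
      rw [← Real.rpow_natCast]
      congr 1
      linarith [natFloor_add_fract ha]
    rw [fracPow, if_pos hf, pow_succ, mul_apply_eq_comp, h.generator_pow_lowPass_pow hγ, norm_smul,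
      Real.norm_of_nonneg (by positivity), hγa]
    calc _ ≤ γ ^ ⌊a⌋₊ * ((1 + κ) ^ ⌊a⌋₊ * (κ * ‖x‖)) := by
          gcongr
          exact (hP γ hγ _ _).trans
            (mul_le_mul_of_nonneg_left (h.norm_lowPass_apply_le hγ x) (by positivity))
      _ = _ := by ring
  · have hq : 0 < Int.fract a := lt_of_le_of_ne (Int.fract_nonneg a) (Ne.symm hf)
    have hq1 := Int.fract_lt_one a
    obtain ⟨C, hC, hle⟩ := h.exists_norm_lowPass_balakrishnan_le hκ hq hq1
    refine ⟨C * (1 + κ) ^ ⌊a⌋₊, by positivity, fun γ hγ x => ?_⟩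
    have hγa : γ ^ a = γ ^ Int.fract a * γ ^ ⌊a⌋₊ := by
      rw [← Real.rpow_natCast, ← Real.rpow_add hγ, add_comm, natFloor_add_fract ha]
    have e : (G ^ ⌊a⌋₊) ((lowPass G γ ^ (⌊a⌋₊ + 1)) x) =
        lowPass G γ (γ ^ ⌊a⌋₊ • (highPass G γ ^ ⌊a⌋₊) x) := by
      rw [← h.generator_pow_lowPass_pow hγ, pow_succ', mul_apply_eq_comp]
      exact congrArg (fun T : X →L[ℝ] X => T ((lowPass G γ ^ ⌊a⌋₊) x))
        ((h.commute_generator_lowPass hγ).pow_left ⌊a⌋₊).eq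
    rw [fracPow, if_neg hf, e, ← h.apply_balakrishnan_of_commute hq hq1
      fun s hs => h.commute_lowPass_highPass hγ hs]
    refine (hle γ hγ _).trans ?_
    rw [norm_smul, Real.norm_of_nonneg (by positivity), hγa]
    calc _ ≤ C * γ ^ Int.fract a * (γ ^ ⌊a⌋₊ * ((1 + κ) ^ ⌊a⌋₊ * ‖x‖)) := by
          gcongr
          exact hP γ hγ _ _
      _ = _ := by ring

/-- An additive form of the interpolation inequality between `‖·‖_{-a}` and `‖·‖_1`. -/
theorem exists_norm_generator_le (h : HasResolventBound G κ) (hκ : 0 < κ) (ha : 0 ≤ a) :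
    ∃ C : ℝ, 0 < C ∧ ∀ γ : ℝ, 0 < γ → ∀ v : X,
      ‖G v‖ ≤ C * (γ * ‖v‖ + γ ^ (-a) * ‖fracPow G a (G v)‖) := by
  obtain ⟨C, hC, hle⟩ : ∃ C : ℝ, 0 < C ∧ ∀ γ : ℝ, 0 < γ → ∀ x : X,
      ‖highPass G γ ((G ^ ⌊a⌋₊) x)‖ ≤ C * γ ^ (-Int.fract a) * ‖fracPow G a x‖ := by
    by_cases hf : Int.fract a = 0
    · refine ⟨1 + κ, by linarith, fun γ hγ x => ?_⟩
      rw [hf, neg_zero, Real.rpow_zero, mul_one, fracPow, if_pos hf]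
      exact h.norm_highPass_apply_le hγ _
    · obtain ⟨C, hC, hle⟩ := h.exists_norm_highPass_le_balakrishnan hκ
        (lt_of_le_of_ne (Int.fract_nonneg a) (Ne.symm hf)) (Int.fract_lt_one a)
      refine ⟨C, hC, fun γ hγ x => ?_⟩
      rw [fracPow, if_neg hf]
      exact hle γ hγ _
  set n := ⌊a⌋₊ with hn
  set S := ∑ k ∈ Finset.range (n + 1), (1 + κ) ^ k with hS
  have hS0 : 0 ≤ S := Finset.sum_nonneg fun k _ => by positivity
  refine ⟨max (S * (1 + κ)) (κ ^ n * C), lt_max_of_lt_right (by positivity), fun γ hγ v => ?_⟩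
  have comm : Commute (highPass G γ) (∑ k ∈ Finset.range (n + 1), highPass G γ ^ k) :=
    Commute.sum_right _ _ _ fun k _ => (Commute.refl _).pow_right k
  -- The geometric sum splits `G v` into high and low frequencies.
  have e1 : G v = (highPass G γ ^ (n + 1)) (G v) +
      (∑ k ∈ Finset.range (n + 1), highPass G γ ^ k) (lowPass G γ (G v)) := by
    have hl : lowPass G γ = 1 - highPass G γ := by rw [h.highPass_eq hγ]; abel
    have e : (∑ k ∈ Finset.range (n + 1), highPass G γ ^ k) * lowPass G γ =
        1 - highPass G γ ^ (n + 1) := by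
      rw [hl, ← mul_neg_geom_sum]
      exact (((Commute.one_left _).sub_left comm).eq).symm
    have := congrArg (fun T : X →L[ℝ] X => T (G v)) e
    simp only [mul_apply_eq_comp, sub_apply, one_apply_eq_self] at this
    rw [this]
    abel
  have b1 : ‖(∑ k ∈ Finset.range (n + 1), highPass G γ ^ k) (lowPass G γ (G v))‖ ≤
      S * (1 + κ) * (γ * ‖v‖) := by
    rw [sum_apply]
    calc _ ≤ ∑ k ∈ Finset.range (n + 1), (1 + κ) ^ k * ‖lowPass G γ (G v)‖ :=
          norm_sum_le_of_le _ fun k _ =>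
            norm_pow_apply_le (by linarith) (h.norm_highPass_apply_le hγ) k _
      _ = S * ‖lowPass G γ (G v)‖ := by rw [← Finset.sum_mul]
      _ ≤ S * (γ * ((1 + κ) * ‖v‖)) := by
          gcongr
          exact h.norm_lowPass_generator_le hγ v
      _ = _ := by ring
  have e2 : (highPass G γ ^ (n + 1)) (G v) =
      (resolv G γ ^ n) (highPass G γ ((G ^ n) (G v))) := by
    have hcG : Commute G (highPass G γ) := (Commute.refl G).mul_right (h.commute_generator hγ)
    have : highPass G γ ^ (n + 1) = resolv G γ ^ n * (highPass G γ * G ^ n) := by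
      rw [pow_succ, ← (hcG.pow_left n).eq, ← mul_assoc]
      congr 1
      rw [highPass, (h.commute_generator hγ).mul_pow,
        ((h.commute_generator hγ).pow_pow n n).eq]
    exact congrArg (fun T : X →L[ℝ] X => T (G v)) this
  have hγa : γ ^ (-a) = (γ⁻¹) ^ n * γ ^ (-Int.fract a) := by
    rw [inv_pow, ← Real.rpow_natCast, ← Real.rpow_neg hγ.le, ← Real.rpow_add hγ]
    congr 1
    linarith [natFloor_add_fract ha]
  have b2 : ‖(highPass G γ ^ (n + 1)) (G v)‖ ≤
      κ ^ n * C * (γ ^ (-a) * ‖fracPow G a (G v)‖) := by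
    rw [e2]
    calc _ ≤ (κ / γ) ^ n * (C * γ ^ (-Int.fract a) * ‖fracPow G a (G v)‖) :=
          (norm_pow_apply_le (by positivity) (h.norm_resolv_apply_le hγ) n _).trans
            (mul_le_mul_of_nonneg_left (hle γ hγ _) (by positivity))
      _ = _ := by rw [hγa, div_eq_mul_inv, mul_pow]; ring
  calc ‖G v‖ ≤ κ ^ n * C * (γ ^ (-a) * ‖fracPow G a (G v)‖) + S * (1 + κ) * (γ * ‖v‖) := by
        conv_lhs => rw [e1]
        exact (norm_add_le _ _).trans (add_le_add b2 b1)
    _ ≤ max (S * (1 + κ)) (κ ^ n * C) * (γ ^ (-a) * ‖fracPow G a (G v)‖) +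
          max (S * (1 + κ)) (κ ^ n * C) * (γ * ‖v‖) := by
        gcongr
        · exact le_max_right _ _
        · exact le_max_left _ _
    _ = _ := by ring

end HasResolventBound

end ScaleEstimates

/-! ### Decay of the low frequencies under smoothness assumptions -/

section Smoothness

variable {X : Type*} [NormedAddCommGroup X] [NormedSpace ℝ X] {G : X →L[ℝ] X} {κ : ℝ} {x : X}

namespace HasResolventBound

theorem exists_norm_lowPass_le_of_mem_closure (h : HasResolventBound G κ) (hκ : 0 < κ)
    (hx : x ∈ closure (range G)) {ε : ℝ} (hε : 0 < ε) :
    ∃ γ₀ : ℝ, 0 < γ₀ ∧ ∀ γ : ℝ, 0 < γ → γ ≤ γ₀ → ‖lowPass G γ x‖ ≤ ε := by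
  obtain ⟨_, ⟨v, rfl⟩, hv⟩ := Metric.mem_closure_iff.1 hx (ε / (2 * κ)) (by positivity)
  rw [dist_eq_norm] at hv
  refine ⟨ε / (2 * ((1 + κ) * ‖v‖ + 1)), by positivity, fun γ hγ hγ₀ => ?_⟩
  have e : lowPass G γ x = lowPass G γ (x - G v) + lowPass G γ (G v) := by
    rw [← map_add, sub_add_cancel]
  have b1 : ‖lowPass G γ (x - G v)‖ ≤ ε / 2 := by
    calc _ ≤ κ * (ε / (2 * κ)) := (h.norm_lowPass_apply_le hγ _).trans (by gcongr)
      _ = ε / 2 := by field_simp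
  have b2 : ‖lowPass G γ (G v)‖ ≤ ε / 2 := by
    rw [le_div_iff₀ (by positivity)] at hγ₀
    nlinarith [h.norm_lowPass_generator_le hγ v]
  rw [e]
  linarith [norm_add_le (lowPass G γ (x - G v)) (lowPass G γ (G v))]

variable [CompleteSpace X]

theorem exists_norm_lowPass_le_of_mem_scaleSpace (h : HasResolventBound G κ) (hκ : 0 < κ)
    {p : ℝ} (hp : 0 < p) (hp1 : p ≤ 1) (hx : x ∈ scaleSpace G p) :
    ∃ C : ℝ, 0 ≤ C ∧ ∀ γ : ℝ, 0 < γ → ‖lowPass G γ x‖ ≤ C * γ ^ p := by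
  rw [scaleSpace, if_pos hp] at hx
  obtain ⟨v, rfl⟩ := hx
  rcases hp1.lt_or_eq with hp1 | rfl
  · obtain ⟨C, hC, hle⟩ := h.exists_norm_lowPass_balakrishnan_le hκ hp hp1
    refine ⟨C * ‖v‖, by positivity, fun γ hγ => ?_⟩
    rw [fracPow_of_mem_Ioo hp hp1]
    exact (hle γ hγ v).trans_eq (by ring)
  · refine ⟨(1 + κ) * ‖v‖, by positivity, fun γ hγ => ?_⟩
    rw [fracPow_one, Real.rpow_one]
    exact (h.norm_lowPass_generator_le hγ v).trans_eq (by ring)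

/-- For `x` in the domain of `log G` the low frequencies decay logarithmically. With
`p = M / log (1 / γ)` the difference `G ^ p x - x` is of size `p`, while the low frequencies of
`G ^ p x` are at most half of those of `x`, up to an error of size `p`. -/
theorem exists_norm_lowPass_le_of_mem_logDomain (h : HasResolventBound G κ) (hκ : 0 < κ)
    (hx : x ∈ logDomain G) :
    ∃ C γ₀ : ℝ, 0 < C ∧ 0 < γ₀ ∧ γ₀ < 1 ∧ ∀ γ : ℝ, 0 < γ → γ ≤ γ₀ →
      ‖lowPass G γ x‖ ≤ C / Real.log (1 / γ) := by
  obtain ⟨v, hv⟩ := hx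
  have hev : ∀ᶠ p : ℝ in 𝓝[>] 0, ‖p⁻¹ • (fracPow G p x - x)‖ < ‖v‖ + 1 :=
    hv.norm.eventually_lt_const (lt_add_one _)
  obtain ⟨p₀, hp₀, hsub⟩ := mem_nhdsGT_iff_exists_Ioo_subset.1 hev
  have hp₀ : 0 < p₀ := hp₀
  -- This choice of `M` gives `(1 + κ) γ ^ p = 1 / 2` below.
  set M := Real.log (2 * (1 + κ)) with hM
  have hMpos : 0 < M := Real.log_pos (by linarith)
  set d := min p₀ (1 / 2) with hd
  have hdpos : 0 < d := lt_min hp₀ (by norm_num)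
  refine ⟨2 * κ * (‖v‖ + 1 + ‖x‖) * M, Real.exp (-(M / d + 1)), by positivity,
    Real.exp_pos _, Real.exp_lt_one_iff.2 (by have := div_pos hMpos hdpos; linarith),
    fun γ hγ hγ₀ => ?_⟩
  set Λ := Real.log (1 / γ) with hΛ
  have hΛγ : Real.log γ = -Λ := by rw [hΛ, one_div, Real.log_inv, neg_neg]
  have hΛ1 : M / d + 1 ≤ Λ := by
    have := (Real.log_le_iff_le_exp hγ).2 hγ₀
    linarith
  have hΛpos : 0 < Λ := by have := div_pos hMpos hdpos; linarith
  set p := M / Λ with hp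
  have hppos : 0 < p := div_pos hMpos hΛpos
  have hpd : p < d := by
    rw [hp, div_lt_iff₀ hΛpos, ← div_lt_iff₀' hdpos]
    linarith
  have hp12 : p < 1 / 2 := hpd.trans_le (min_le_right _ _)
  have hp1 : p < 1 := by linarith
  have hγp : γ ^ p = (2 * (1 + κ))⁻¹ := by
    rw [Real.rpow_def_of_pos hγ, hΛγ, hp, neg_mul, mul_div_cancel₀ _ hΛpos.ne', Real.exp_neg, hM,
      Real.exp_log (by positivity)]
  have b1 : ‖x - balakrishnan G p x‖ ≤ (‖v‖ + 1) * p := by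
    have : ‖p⁻¹ • (fracPow G p x - x)‖ < ‖v‖ + 1 :=
      hsub ⟨hppos, hpd.trans_le (min_le_left _ _)⟩
    rw [norm_smul, norm_inv, Real.norm_of_nonneg hppos.le, inv_mul_lt_iff₀ hppos,
      fracPow_of_mem_Ioo hppos hp1, norm_sub_rev] at this
    linarith
  have b2 : ‖lowPass G γ (balakrishnan G p x)‖ ≤ ‖lowPass G γ x‖ / 2 + κ * ‖x‖ * p := by
    have hsin : Real.sin (Real.pi * p) / Real.pi ≤ p := by
      rw [div_le_iff₀ Real.pi_pos, mul_comm p]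
      exact Real.sin_le (by positivity)
    have hfrac : κ * (1 + κ) * ‖x‖ / (1 - p) ≤ κ * (1 + κ) * ‖x‖ * 2 := by
      rw [div_le_iff₀ (by linarith)]
      have : 0 ≤ κ * (1 + κ) * ‖x‖ := by positivity
      nlinarith
    refine (h.norm_lowPass_balakrishnan_le hκ hppos hp1 hγ x).trans ?_
    rw [hγp]
    have : 0 < 1 - p := by linarith
    calc _ ≤ p * ((2 * (1 + κ))⁻¹ * ((1 + κ) * ‖lowPass G γ x‖ / p +
          κ * (1 + κ) * ‖x‖ * 2)) := by gcongr
      _ = _ := by field_simp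
  have e : lowPass G γ x = lowPass G γ (x - balakrishnan G p x) +
      lowPass G γ (balakrishnan G p x) := by rw [← map_add, sub_add_cancel]
  have b3 : ‖lowPass G γ (x - balakrishnan G p x)‖ ≤ κ * ((‖v‖ + 1) * p) :=
    (h.norm_lowPass_apply_le hγ _).trans (by gcongr)
  have b4 : ‖lowPass G γ x‖ ≤ ‖lowPass G γ (x - balakrishnan G p x)‖ +
      ‖lowPass G γ (balakrishnan G p x)‖ := by
    conv_lhs => rw [e]
    exact norm_add_le _ _
  calc ‖lowPass G γ x‖ ≤ 2 * κ * (‖v‖ + 1 + ‖x‖) * p := by linarith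
    _ = _ := by rw [hp]; ring

end HasResolventBound

end Smoothness

/-! ### Tikhonov minimizers chosen by the discrepancy principle -/

section Tikhonov

variable {X Y : Type*} [NormedAddCommGroup X] [NormedSpace ℝ X] [NormedAddCommGroup Y]
  {G : X →L[ℝ] X} {F : X → Y} {D : Set X} {r : ℝ} {f : Y}

theorem mem_scaleSpace_one {u : X} : u ∈ scaleSpace G 1 ↔ ∃ v, G v = u := by
  simp [scaleSpace, fracPow_one]

theorem scaleNorm_one_generator (hG : Function.Injective G) (v : X) :
    scaleNorm G 1 (G v) = ‖v‖ := by
  have e : fracPow G 1 = G := funext fracPow_one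
  rw [scaleNorm, if_pos one_pos, e, Function.leftInverse_invFun hG]

theorem scaleNorm_neg {a : ℝ} (ha : 0 < a) (u : X) : scaleNorm G (-a) u = ‖fracPow G a u‖ := by
  rw [scaleNorm, if_neg (by linarith), neg_neg]

theorem tikhonov_generator (hG : Function.Injective G) {α : ℝ} (hα : 0 < α) (g v : X) :
    tikhonov G F r (G g) f α (G v) =
      ENNReal.ofReal (‖F (G v) - f‖ ^ r + α * ‖v - g‖ ^ r) := by
  rw [tikhonov, penalty, if_pos (mem_scaleSpace_one.2 ⟨v, rfl⟩), ← map_sub,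
    scaleNorm_one_generator hG, ← ENNReal.ofReal_mul hα.le, ← ENNReal.ofReal_add]
  · exact Real.rpow_nonneg (norm_nonneg _) _
  · exact mul_nonneg hα.le (Real.rpow_nonneg (norm_nonneg _) _)

/-- A minimizer has finite penalty, and the minimality is an inequality between real numbers. -/
theorem IsRegularizedSolution.exists_preimage (hG : Function.Injective G) {α : ℝ} (hα : 0 < α)
    {g u : X} (hg : G g ∈ D) (hu : IsRegularizedSolution G F D r (G g) f α u) :
    ∃ w, u = G w ∧ ∀ v, G v ∈ D →
      ‖F u - f‖ ^ r + α * ‖w - g‖ ^ r ≤ ‖F (G v) - f‖ ^ r + α * ‖v - g‖ ^ r := by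
  have hmem : u ∈ scaleSpace G 1 := by
    by_contra hmem
    have := hu.2 _ hg
    rw [tikhonov_generator hG hα, tikhonov, penalty, if_neg hmem,
      ENNReal.mul_top (ENNReal.ofReal_pos.2 hα).ne', add_top, top_le_iff] at this
    exact ENNReal.ofReal_ne_top this
  obtain ⟨w, rfl⟩ := mem_scaleSpace_one.1 hmem
  refine ⟨w, rfl, fun v hv => ?_⟩
  have := hu.2 _ hv
  rw [tikhonov_generator hG hα, tikhonov_generator hG hα] at this
  refine (ENNReal.ofReal_le_ofReal_iff ?_).1 this
  exact add_nonneg (Real.rpow_nonneg (norm_nonneg _) _)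
    (mul_nonneg hα.le (Real.rpow_nonneg (norm_nonneg _) _))

theorem one_le_thresholdConst (hr : 0 < r) : 1 ≤ thresholdConst r := by
  rw [thresholdConst]
  split_ifs with h
  · exact le_rfl
  · have : 1 ≤ 1 / r := by rw [le_div_iff₀ hr]; linarith
    exact Real.one_le_rpow (by norm_num) (by linarith)

/-- If some element of the domain has a residual well below the threshold of the discrepancy
principle, then the penalty of the chosen minimizer is at most a multiple of the penalty of that
element. Minimality at the parameter `β`, where the residual exceeds the threshold, bounds
`α` from below; minimality at `α` then bounds the penalty. -/
theorem IsDiscrepancyChoice.exists_preimage (hG : Function.Injective G) (hr : 0 < r)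
    {b b' c δ : ℝ} (hc : 0 < c) (hb' : 0 < b') (hbb : b' < b) (hδ : 0 < δ) {g u v : X}
    {α : WithTop ℝ} (hg : G g ∈ D) (hv : G v ∈ D) (hvf : ‖F (G v) - f‖ ≤ b' * δ)
    (hu : IsDiscrepancyChoice G F D r (G g) b c δ f α u) :
    ∃ w, u = G w ∧ ‖F u - f‖ ≤ b * δ ∧
      ‖w - g‖ ≤ (1 + b' ^ r * c / (b ^ r - b' ^ r)) ^ (1 / r) * ‖v - g‖ := by
  have hpow : 0 < b ^ r - b' ^ r := sub_pos.2 (Real.rpow_lt_rpow hb'.le hbb hr)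
  rcases hu with ⟨hfu, -, rfl⟩ | ⟨-, α, -, hα, hsol, hfu, β, z, hαβ, hβc, hz, hzf⟩
  -- For `α = ∞` the chosen element is the initial guess, whose penalty vanishes.
  · refine ⟨g, rfl, hfu, ?_⟩
    rw [sub_self, norm_zero]
    have hK : 0 ≤ 1 + b' ^ r * c / (b ^ r - b' ^ r) := by positivity
    exact mul_nonneg (Real.rpow_nonneg hK _) (norm_nonneg _)
  · obtain ⟨w, rfl, hw⟩ := hsol.exists_preimage hG hα hg
    obtain ⟨y, rfl, hy⟩ := hz.exists_preimage hG (hα.trans_le hαβ) hg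
    refine ⟨w, rfl, hfu, ?_⟩
    have hN : 0 ≤ ‖v - g‖ ^ r := Real.rpow_nonneg (norm_nonneg _) _
    have h1 := hw v hv
    have h2 := hy v hv
    have h3 : ‖F (G v) - f‖ ^ r ≤ b' ^ r * δ ^ r := by
      rw [← Real.mul_rpow hb'.le hδ.le]
      exact Real.rpow_le_rpow (norm_nonneg _) hvf hr.le
    have h4 : b ^ r * δ ^ r ≤ ‖F (G y) - f‖ ^ r := by
      rw [← Real.mul_rpow (hb'.trans hbb).le hδ.le]
      exact Real.rpow_le_rpow (mul_nonneg (hb'.trans hbb).le hδ.le) hzf hr.le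
    have h5 : 0 ≤ ‖F (G w) - f‖ ^ r := Real.rpow_nonneg (norm_nonneg _) _
    have h6 : 0 ≤ β * ‖y - g‖ ^ r :=
      mul_nonneg (hα.le.trans hαβ) (Real.rpow_nonneg (norm_nonneg _) _)
    have h7 : δ ^ r * (b ^ r - b' ^ r) ≤ c * α * ‖v - g‖ ^ r := by
      have := mul_le_mul_of_nonneg_right hβc hN
      nlinarith
    have h8 : δ ^ r ≤ c * α * ‖v - g‖ ^ r / (b ^ r - b' ^ r) := (le_div_iff₀ hpow).2 h7
    have h9 : α * ‖w - g‖ ^ r ≤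
        α * ((1 + b' ^ r * c / (b ^ r - b' ^ r)) * ‖v - g‖ ^ r) := by
      have := mul_le_mul_of_nonneg_left h8 (Real.rpow_nonneg hb'.le r)
      calc α * ‖w - g‖ ^ r ≤ b' ^ r * δ ^ r + α * ‖v - g‖ ^ r := by linarith
        _ ≤ b' ^ r * (c * α * ‖v - g‖ ^ r / (b ^ r - b' ^ r)) + α * ‖v - g‖ ^ r := by linarith
        _ = _ := by ring
    have hK : 0 ≤ 1 + b' ^ r * c / (b ^ r - b' ^ r) := by positivity
    have h10 := le_of_mul_le_mul_left h9 hα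
    rw [← Real.rpow_le_rpow_iff (norm_nonneg _) (by positivity) hr,
      Real.mul_rpow (by positivity) (norm_nonneg _), ← Real.rpow_mul hK, one_div,
      inv_mul_cancel₀ hr.ne', Real.rpow_one]
    exact h10

end Tikhonov

/-! ### The error estimate -/

section ErrorEstimate

variable {X Y Z : Type*} [NormedAddCommGroup X] [NormedSpace ℝ X] [CompleteSpace X]
  [NormedAddCommGroup Y] [NormedSpace ℝ Y] [NormedAddCommGroup Z] [NormedSpace ℝ Z]

/-- The error of the regularized solution in terms of an arbitrary cut-off frequency `γ` and a
bound `φ` for the low frequencies of `udag - ubar`. The comparison element is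
`udag - L ^ m (udag - ubar)` with `L = γ (G + γ I)⁻¹`; it differs from `udag` by `O(φ)` in `X` and
by `O(γ ^ a φ)` in the weak norm, so that its residual lies below the threshold, while its penalty
is `O(φ / γ)`. -/
theorem MainAssumption.exists_norm_sub_le {J : X ≃ₗᵢ[ℝ] StrongDual ℝ Z} {G : X →L[ℝ] X}
    {F : X → Y} {D : Set X} {fdag : Y} {udag ubar : X} {a ca cb c₀ c₁ r b c κ : ℝ}
    (hA : MainAssumption J G F D fdag udag ubar a ca cb c₀ c₁)
    (hr : 0 < r) (hb : 1 < b) (hc : 0 < c) (h : HasResolventBound G κ) (hκ : 0 < κ) :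
    ∃ C₁ C₂ φ₀ δ₀ : ℝ, 0 < C₁ ∧ 0 < C₂ ∧ 0 < φ₀ ∧ 0 < δ₀ ∧ ∀ γ φ δ : ℝ, 0 < γ →
      ‖lowPass G γ (udag - ubar)‖ ≤ φ → φ ≤ φ₀ → 0 < δ → δ ≤ δ₀ → C₁ * γ ^ a * φ ≤ δ →
      ∀ f : Y, ‖f - fdag‖ ≤ δ → ∀ (α : WithTop ℝ) (u : X),
        IsDiscrepancyChoice G F D r ubar b c δ f α u →
          ‖u - udag‖ ≤ C₂ * (φ + γ ^ (-a) * δ) := by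
  have ha := hA.a_pos
  have hca := hA.ca_pos
  have hcb : 0 < cb := hca.trans_le hA.ca_le_cb
  have hc₀ := hA.c₀_pos
  have hc₁ := hA.c₁_pos
  have hG := hA.generator.injective
  have hb1 : 0 < b - 1 := by linarith
  obtain ⟨g, rfl⟩ := mem_scaleSpace_one.1 hA.guess_mem.1
  obtain ⟨ρ, hρ, hball⟩ := Metric.isOpen_iff.1 isOpen_interior _ hA.solution_interior
  obtain ⟨Cs, hCs, hs⟩ := h.exists_norm_fracPow_lowPass_pow_le hκ ha.le
  obtain ⟨Cv, hCv, hv⟩ := h.exists_sub_lowPass_pow hκ (⌊a⌋₊ + 1 + 1)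
  obtain ⟨Ci, hCi, hi⟩ := h.exists_norm_generator_le hκ ha.le
  set n := ⌊a⌋₊ + 1 with hn
  set K := (1 + ((1 + b) / 2) ^ r * c / (b ^ r - ((1 + b) / 2) ^ r)) ^ (1 / r) with hK
  have hK0 : 0 ≤ K := by
    have : 0 < b ^ r - ((1 + b) / 2) ^ r :=
      sub_pos.2 (Real.rpow_lt_rpow (by linarith) (by linarith) hr)
    positivity
  set B := (b + 1) / ca + (b - 1) / (2 * cb) with hB
  have hB0 : 0 < B := by positivity
  -- `C₁` and `δ₀` make the residual of the comparison element at most `b' δ`, `b' = (1 + b) / 2`,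
  -- and `φ₀` puts that element into the ball around `udag` contained in the domain.
  refine ⟨2 * cb * Cs / (b - 1), Ci * ((K + 1) * Cv + B) + κ ^ n, ρ / (2 * κ ^ n),
    min (2 * cb * c₀ / (b - 1)) (c₁ / (b + 1)), by positivity, by positivity, by positivity,
    lt_min (by positivity) (by positivity), ?_⟩
  intro γ φ δ hγ hφ hφ₀ hδ hδ₀ hγδ f hf α u hu
  have hφ0 : 0 ≤ φ := (norm_nonneg _).trans hφ
  have hγa := Real.rpow_pos_of_pos hγ a
  have hγa' := Real.rpow_pos_of_pos hγ (-a)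
  set x := udag - G g with hx
  set y := (lowPass G γ ^ (n + 1)) x with hy
  have hy' : y = (lowPass G γ ^ n) (lowPass G γ x) := by rw [hy, pow_succ]; rfl
  obtain ⟨v, hxv, hvn⟩ := hv γ hγ x
  have hvφ : ‖v‖ ≤ Cv * (φ / γ) := hvn.trans (by gcongr)
  have hyn : ‖y‖ ≤ κ ^ n * φ := by
    rw [hy']
    exact (norm_pow_apply_le hκ.le (h.norm_lowPass_apply_le hγ) n _).trans (by gcongr)
  have hG' : G (g + v) = udag - y := by
    rw [map_add, ← hxv, hx]; abel
  -- `G (g + v)` is the comparison element.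
  have hmem : G (g + v) ∈ D := by
    refine interior_subset (hball ?_)
    rw [hG', Metric.mem_ball, dist_eq_norm, sub_sub_cancel_left, norm_neg]
    have hκn : 0 < κ ^ n := by positivity
    rw [le_div_iff₀ (by positivity)] at hφ₀
    nlinarith
  have hweak : scaleNorm G (-a) (G (g + v) - udag) ≤ (b - 1) / (2 * cb) * δ := by
    rw [scaleNorm_neg ha, h.fracPow_sub, norm_sub_rev, ← h.fracPow_sub, hG', sub_sub_cancel, hy']
    calc _ ≤ Cs * γ ^ a * φ := (hs γ hγ _).trans (by gcongr)
      _ = (b - 1) / (2 * cb) * (2 * cb * Cs / (b - 1) * γ ^ a * φ) := by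
          field_simp
      _ ≤ _ := by gcongr
  have hres : ‖F (G (g + v)) - f‖ ≤ (1 + b) / 2 * δ := by
    have h1 : ‖F (G (g + v)) - fdag‖ ≤ (b - 1) / 2 * δ := by
      refine (hA.upper _ ⟨hmem, mem_scaleSpace_one.2 ⟨_, rfl⟩⟩ (hweak.trans ?_)).trans ?_
      · calc _ ≤ (b - 1) / (2 * cb) * (2 * cb * c₀ / (b - 1)) := by
              gcongr
              exact hδ₀.trans (min_le_left _ _)
          _ = c₀ := by field_simp
      · calc _ ≤ cb * ((b - 1) / (2 * cb) * δ) := by gcongr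
          _ = _ := by field_simp
    rw [norm_sub_rev] at hf
    linarith [norm_sub_le_norm_sub_add_norm_sub (F (G (g + v))) fdag f]
  obtain ⟨w, rfl, hfu, hw⟩ := hu.exists_preimage hG hr hc (by linarith : 0 < (1 + b) / 2)
    (by linarith) hδ hA.guess_mem.2 hmem hres
  rw [← hK, add_sub_cancel_left] at hw
  have huD : G w ∈ D := by
    rcases hu with ⟨-, -, e⟩ | ⟨-, _, -, -, hsol, -⟩
    · exact e ▸ hA.guess_mem.2
    · exact hsol.1
  have hlow : scaleNorm G (-a) (G w - udag) ≤ (b + 1) / ca * δ := by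
    have h1 : ‖F (G w) - fdag‖ ≤ (b + 1) * δ := by
      linarith [norm_sub_le_norm_sub_add_norm_sub (F (G w)) f fdag]
    have h2 : (b + 1) * δ ≤ c₁ := by
      have := hδ₀.trans (min_le_right _ _)
      rw [le_div_iff₀ (by linarith)] at this
      linarith
    have h3 := hA.lower _ ⟨huD, mem_scaleSpace_one.2 ⟨_, rfl⟩⟩ (h1.trans h2)
    rw [div_mul_eq_mul_div, le_div_iff₀ hca]
    linarith
  have hdiff : ‖fracPow G a (G (w - (g + v)))‖ ≤ B * δ := by
    have e : fracPow G a (G (w - (g + v))) =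
        fracPow G a (G w - udag) - fracPow G a (G (g + v) - udag) := by
      rw [← h.fracPow_sub, map_sub]
      congr 1
      abel
    rw [scaleNorm_neg ha] at hlow hweak
    rw [e, hB, add_mul]
    exact (norm_sub_le _ _).trans (add_le_add hlow hweak)
  have hwv : ‖w - (g + v)‖ ≤ (K + 1) * Cv * (φ / γ) := by
    rw [← sub_sub]
    calc _ ≤ ‖w - g‖ + ‖v‖ := norm_sub_le _ _
      _ ≤ K * ‖v‖ + ‖v‖ := by gcongr
      _ = (K + 1) * ‖v‖ := by ring
      _ ≤ (K + 1) * (Cv * (φ / γ)) := by gcongr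
      _ = _ := by ring
  have hint : ‖G (w - (g + v))‖ ≤ Ci * ((K + 1) * Cv * φ + B * (γ ^ (-a) * δ)) := by
    calc _ ≤ Ci * (γ * ((K + 1) * Cv * (φ / γ)) + γ ^ (-a) * (B * δ)) :=
          (hi γ hγ _).trans (by gcongr)
      _ = _ := by field_simp
  have e : G w - udag = G (w - (g + v)) - y := by
    rw [map_sub, hG']; abel
  rw [e]
  have hp1 : 0 ≤ Ci * B * φ := by positivity
  have hp2 : 0 ≤ (Ci * ((K + 1) * Cv) + κ ^ n) * (γ ^ (-a) * δ) := by positivity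
  calc _ ≤ Ci * ((K + 1) * Cv * φ + B * (γ ^ (-a) * δ)) + κ ^ n * φ :=
        (norm_sub_le _ _).trans (add_le_add hint hyn)
    _ ≤ _ := by linarith

end ErrorEstimate

/-! ### Choice of the cut-off frequency -/

section CutOff

/-- An error estimate with a free cut-off frequency `γ`: the error `e` is admissible at the noise
level `δ`, in symbols `Q δ e`, if `e` has the form given by a bound `φ` for the low frequencies
`N γ`, provided that `γ ^ a φ` does not exceed a multiple of `δ`. -/
structure CutOffEstimate (Q : ℝ → ℝ → Prop) (N : ℝ → ℝ) (a C₁ C₂ φ₀ δ₀ : ℝ) : Prop where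
  a_pos : 0 < a
  C₁_pos : 0 < C₁
  C₂_pos : 0 < C₂
  φ₀_pos : 0 < φ₀
  δ₀_pos : 0 < δ₀
  mono : ∀ δ e e' : ℝ, e ≤ e' → Q δ e → Q δ e'
  estimate : ∀ γ φ δ : ℝ, 0 < γ → N γ ≤ φ → φ ≤ φ₀ → 0 < δ → δ ≤ δ₀ → C₁ * γ ^ a * φ ≤ δ →
    Q δ (C₂ * (φ + γ ^ (-a) * δ))

namespace CutOffEstimate

variable {Q : ℝ → ℝ → Prop} {N : ℝ → ℝ} {a C₁ C₂ φ₀ δ₀ : ℝ}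

/-- The cut-off frequency is chosen such that `γ ^ a` is a large multiple of `δ`. -/
theorem exists_le_of_tendsto (H : CutOffEstimate Q N a C₁ C₂ φ₀ δ₀)
    (hN : ∀ ε : ℝ, 0 < ε → ∃ γ₀ : ℝ, 0 < γ₀ ∧ ∀ γ : ℝ, 0 < γ → γ ≤ γ₀ → N γ ≤ ε)
    {ε : ℝ} (hε : 0 < ε) : ∃ δ₁ : ℝ, 0 < δ₁ ∧ ∀ δ : ℝ, 0 < δ → δ ≤ δ₁ → Q δ ε := by
  have ha := H.a_pos
  have hC₁ := H.C₁_pos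
  have hC₂ := H.C₂_pos
  set e := ε / (2 * C₂) with he
  have hepos : 0 < e := by positivity
  set φ := min φ₀ (min e (e / C₁)) with hφ
  obtain ⟨γ₀, hγ₀, hle⟩ := hN φ (lt_min H.φ₀_pos (lt_min hepos (by positivity)))
  refine ⟨min δ₀ (e * γ₀ ^ a), lt_min H.δ₀_pos (by positivity), fun δ hδ hδ₁ => ?_⟩
  have hγ : 0 < (δ / e) ^ (1 / a) := by positivity
  have hγa : ((δ / e) ^ (1 / a)) ^ a = δ / e := by
    rw [← Real.rpow_mul (by positivity), one_div, inv_mul_cancel₀ ha.ne', Real.rpow_one]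
  have hγle : (δ / e) ^ (1 / a) ≤ γ₀ := by
    rw [← Real.rpow_le_rpow_iff hγ.le hγ₀.le ha, hγa, div_le_iff₀' hepos]
    exact hδ₁.trans (min_le_right _ _)
  refine H.mono _ _ _ ?_ (H.estimate _ φ δ hγ (hle _ hγ hγle) (min_le_left _ _) hδ
    (hδ₁.trans (min_le_left _ _)) ?_)
  · rw [Real.rpow_neg hγ.le, hγa]
    have h1 : φ ≤ e := (min_le_right _ _).trans (min_le_left _ _)
    calc C₂ * (φ + (δ / e)⁻¹ * δ) ≤ C₂ * (e + (δ / e)⁻¹ * δ) := by gcongr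
      _ = ε := by rw [he]; field_simp; ring
  · rw [hγa]
    have h1 : φ ≤ e / C₁ := (min_le_right _ _).trans (min_le_right _ _)
    calc C₁ * (δ / e) * φ ≤ C₁ * (δ / e) * (e / C₁) := by gcongr
      _ = δ := by field_simp

/-- The cut-off frequency is chosen such that `γ ^ (p + a)` is a multiple of `δ`. -/
theorem exists_rpow_of_rpow (H : CutOffEstimate Q N a C₁ C₂ φ₀ δ₀) {p C : ℝ} (hp : 0 < p)
    (hC : 0 < C) (hN : ∀ γ : ℝ, 0 < γ → γ ≤ 1 → N γ ≤ C * γ ^ p) :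
    ∃ C' δ₁ : ℝ, 0 < δ₁ ∧ ∀ δ : ℝ, 0 < δ → δ ≤ δ₁ → Q δ (C' * δ ^ (p / (p + a))) := by
  have ha := H.a_pos
  have hC₁ := H.C₁_pos
  have hpa : 0 < p + a := by linarith
  set k := 1 / (C₁ * C) with hk
  have hkpos : 0 < k := by positivity
  have hlim : ∀ s : ℝ, 0 < s → Tendsto (fun δ : ℝ => (k * δ) ^ s) (𝓝[>] 0) (𝓝 0) := by
    intro s hs
    have h1 : Tendsto (fun δ : ℝ => k * δ) (𝓝 0) (𝓝 0) := by
      simpa using (tendsto_id (α := ℝ) (x := 𝓝 0)).const_mul k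
    have h2 := h1.rpow_const (p := s) (Or.inr hs.le)
    rw [Real.zero_rpow hs.ne'] at h2
    exact h2.mono_left nhdsWithin_le_nhds
  have hev : ∀ᶠ δ : ℝ in 𝓝[>] 0, (k * δ) ^ (1 / (p + a)) ≤ 1 ∧
      C * (k * δ) ^ (p / (p + a)) ≤ φ₀ ∧ δ ≤ δ₀ := by
    have h2 := (hlim (p / (p + a)) (by positivity)).const_mul C
    rw [mul_zero] at h2
    exact ((hlim _ (by positivity)).eventually_le_const one_pos).and
      ((h2.eventually_le_const H.φ₀_pos).and
        ((eventually_le_nhds H.δ₀_pos).filter_mono nhdsWithin_le_nhds))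
  obtain ⟨δ₁, hδ₁, hsub⟩ := mem_nhdsGT_iff_exists_Ioc_subset.1 hev
  refine ⟨C₂ * (C + 1 / k) * k ^ (p / (p + a)), δ₁, hδ₁, fun δ hδ hδle => ?_⟩
  obtain ⟨h1, h2, h3⟩ := hsub ⟨hδ, hδle⟩
  have hkδ : 0 < k * δ := by positivity
  set γ := (k * δ) ^ (1 / (p + a)) with hγdef
  have hγ : 0 < γ := Real.rpow_pos_of_pos hkδ _
  have hγp : γ ^ p = (k * δ) ^ (p / (p + a)) := by
    rw [hγdef, ← Real.rpow_mul hkδ.le]; congr 1; ring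
  have hγpa : γ ^ a * γ ^ p = k * δ := by
    rw [← Real.rpow_add hγ, hγdef, ← Real.rpow_mul hkδ.le, add_comm a, one_div,
      inv_mul_cancel₀ hpa.ne', Real.rpow_one]
  have hδeq : δ = γ ^ a * γ ^ p / k := by rw [hγpa]; field_simp
  refine H.mono _ _ _ (le_of_eq ?_) (H.estimate γ (C * γ ^ p) δ hγ (hN γ hγ h1)
    (hγp ▸ h2) hδ h3 (le_of_eq ?_))
  · have h4 : γ ^ (-a) * δ = γ ^ p / k := by
      rw [Real.rpow_neg hγ.le]
      conv_lhs => rw [hδeq]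
      have := Real.rpow_pos_of_pos hγ a
      field_simp
    rw [h4, hγp, Real.mul_rpow hkpos.le hδ.le]
    ring
  · calc C₁ * γ ^ a * (C * γ ^ p) = C₁ * C * (γ ^ a * γ ^ p) := by ring
      _ = δ := by rw [hγpa, hk]; field_simp

/-- The cut-off frequency is chosen such that `γ ^ a` is a multiple of `δ log (1 / δ)`. Then
`log (1 / γ)` is at least a multiple of `log (1 / δ)`. -/
theorem exists_log_of_log (H : CutOffEstimate Q N a C₁ C₂ φ₀ δ₀) {C γ₀ : ℝ} (hC : 0 < C)
    (hγ₀ : 0 < γ₀)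
    (hN : ∀ γ : ℝ, 0 < γ → γ ≤ γ₀ → N γ ≤ C / Real.log (1 / γ)) :
    ∃ C' δ₁ : ℝ, 0 < δ₁ ∧ δ₁ < 1 ∧ ∀ δ : ℝ, 0 < δ → δ ≤ δ₁ → Q δ (C' / Real.log (1 / δ)) := by
  have ha := H.a_pos
  have hC₁ := H.C₁_pos
  set k := 1 / (2 * a * C₁ * C) with hk
  have hkpos : 0 < k := by positivity
  have hlog : Tendsto (fun δ : ℝ => Real.log (1 / δ)) (𝓝[>] 0) atTop := by
    simp only [one_div]
    exact Real.tendsto_log_atTop.comp tendsto_inv_nhdsGT_zero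
  have hev : ∀ᶠ δ : ℝ in 𝓝[>] 0, k * (Real.log (1 / δ) * δ ^ (1 / 2 : ℝ)) ≤ 1 ∧
      δ ^ (1 / (2 * a)) ≤ γ₀ ∧ 2 * a * C / Real.log (1 / δ) ≤ φ₀ ∧ 0 < Real.log (1 / δ) ∧
      δ ≤ δ₀ ∧ δ < 1 := by
    have h1 : Tendsto (fun δ : ℝ => k * (Real.log (1 / δ) * δ ^ (1 / 2 : ℝ))) (𝓝[>] 0)
        (𝓝 0) := by
      have := (tendsto_log_mul_rpow_nhdsGT_zero (r := 1 / 2) (by norm_num)).neg.const_mul k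
      simpa [Real.log_inv] using this
    have h2 : Tendsto (fun δ : ℝ => δ ^ (1 / (2 * a))) (𝓝[>] 0) (𝓝 0) := by
      have h3 := (tendsto_id (α := ℝ) (x := 𝓝 0)).rpow_const (p := 1 / (2 * a))
        (Or.inr (by positivity))
      rw [Real.zero_rpow (by positivity)] at h3
      exact h3.mono_left nhdsWithin_le_nhds
    have h3 : Tendsto (fun δ : ℝ => 2 * a * C / Real.log (1 / δ)) (𝓝[>] 0) (𝓝 0) :=
      tendsto_const_nhds.div_atTop hlog
    exact (h1.eventually_le_const one_pos).and ((h2.eventually_le_const hγ₀).and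
      ((h3.eventually_le_const H.φ₀_pos).and ((hlog.eventually_gt_atTop 0).and
        (((eventually_le_nhds H.δ₀_pos).and (eventually_lt_nhds one_pos)).filter_mono
          nhdsWithin_le_nhds))))
  obtain ⟨δ₁, hδ₁, hsub⟩ := mem_nhdsGT_iff_exists_Ioc_subset.1 hev
  refine ⟨C₂ * (2 * a * C + 1 / k), δ₁, hδ₁, (hsub ⟨hδ₁, le_rfl⟩).2.2.2.2.2,
    fun δ hδ hδle => ?_⟩
  obtain ⟨h1, h2, h3, hΛ, h5, -⟩ := hsub ⟨hδ, hδle⟩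
  set Λ := Real.log (1 / δ) with hΛdef
  have hm : 0 < k * δ * Λ := by positivity
  set γ := (k * δ * Λ) ^ (1 / a) with hγdef
  have hγ : 0 < γ := Real.rpow_pos_of_pos hm _
  have hγa : γ ^ a = k * δ * Λ := by
    rw [hγdef, ← Real.rpow_mul hm.le, one_div, inv_mul_cancel₀ ha.ne', Real.rpow_one]
  have hmle : k * δ * Λ ≤ δ ^ (1 / 2 : ℝ) := by
    have hδ2 : δ = δ ^ (1 / 2 : ℝ) * δ ^ (1 / 2 : ℝ) := by
      rw [← Real.rpow_add hδ]; norm_num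
    have h6 : 0 ≤ δ ^ (1 / 2 : ℝ) := Real.rpow_nonneg hδ.le _
    calc k * δ * Λ = k * (Λ * δ ^ (1 / 2 : ℝ)) * δ ^ (1 / 2 : ℝ) := by
          conv_lhs => rw [hδ2]
          ring
      _ ≤ 1 * δ ^ (1 / 2 : ℝ) := by gcongr
      _ = _ := one_mul _
  have hγle : γ ≤ δ ^ (1 / (2 * a)) := by
    calc γ ≤ (δ ^ (1 / 2 : ℝ)) ^ (1 / a) := Real.rpow_le_rpow hm.le hmle (by positivity)
      _ = _ := by rw [← Real.rpow_mul hδ.le]; congr 1; field_simp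
  have hlogγ : Λ / (2 * a) ≤ Real.log (1 / γ) := by
    have := Real.log_le_log hγ hγle
    rw [Real.log_rpow hδ] at this
    rw [hΛdef, one_div, one_div, Real.log_inv, Real.log_inv]
    calc -Real.log δ / (2 * a) = -(1 / (2 * a) * Real.log δ) := by ring
      _ ≤ _ := neg_le_neg this
  have hΛa : 0 < Λ / (2 * a) := by positivity
  have hNγ : N γ ≤ 2 * a * C / Λ := by
    calc N γ ≤ C / Real.log (1 / γ) := hN γ hγ (hγle.trans h2)
      _ ≤ C / (Λ / (2 * a)) := by gcongr
      _ = _ := by field_simp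
  refine H.mono _ _ _ (le_of_eq ?_) (H.estimate γ (2 * a * C / Λ) δ hγ hNγ h3 hδ h5
    (le_of_eq ?_))
  · rw [Real.rpow_neg hγ.le, hγa]
    field_simp
  · rw [hγa, hk]
    field_simp

end CutOffEstimate

end CutOff

end BanachScale

/-! ### Convergence and convergence rates -/

theorem theorem4p3
    {X Y Z : Type*}
    [NormedAddCommGroup X] [NormedSpace ℝ X] [CompleteSpace X]
    [NormedAddCommGroup Y] [NormedSpace ℝ Y] [CompleteSpace Y]
    [NormedAddCommGroup Z] [NormedSpace ℝ Z] [TopologicalSpace.SeparableSpace Z]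
    (J : X ≃ₗᵢ[ℝ] StrongDual ℝ Z) (G : X →L[ℝ] X) (F : X → Y) (D : Set X)
    (fdag : Y) (udag ubar : X) (a ca cb c₀ c₁ r b c : ℝ)
    (hA : BanachScale.MainAssumption J G F D fdag udag ubar a ca cb c₀ c₁)
    (hr : 0 < r) (hb : BanachScale.thresholdConst r < b) (hc : 1 < c) :
    -- no explicit smoothness
    (udag ∈ closure (Set.range G) →
      ∀ ε : ℝ, 0 < ε → ∃ δ₀ : ℝ, 0 < δ₀ ∧ ∀ δ : ℝ, 0 < δ → δ ≤ δ₀ →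
        ∀ f : Y, ‖f - fdag‖ ≤ δ → ∀ (α : WithTop ℝ) (u : X),
          BanachScale.IsDiscrepancyChoice G F D r ubar b c δ f α u →
            ‖u - udag‖ ≤ ε) ∧
    -- Hölder smoothness
    (∀ p : ℝ, 0 < p → p ≤ 1 → udag ∈ BanachScale.scaleSpace G p →
      ∃ C δ₀ : ℝ, 0 < δ₀ ∧ ∀ δ : ℝ, 0 < δ → δ ≤ δ₀ →
        ∀ f : Y, ‖f - fdag‖ ≤ δ → ∀ (α : WithTop ℝ) (u : X),
          BanachScale.IsDiscrepancyChoice G F D r ubar b c δ f α u →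
            ‖u - udag‖ ≤ C * δ ^ (p / (p + a))) ∧
    -- low order smoothness
    (udag ∈ BanachScale.logDomain G →
      ∃ C δ₀ : ℝ, 0 < δ₀ ∧ δ₀ < 1 ∧ ∀ δ : ℝ, 0 < δ → δ ≤ δ₀ →
        ∀ f : Y, ‖f - fdag‖ ≤ δ → ∀ (α : WithTop ℝ) (u : X),
          BanachScale.IsDiscrepancyChoice G F D r ubar b c δ f α u →
            ‖u - udag‖ ≤ C / Real.log (1 / δ)) := by
  obtain ⟨κ, hκ, h⟩ := hA.generator.positiveType.exists_hasResolventBound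
  obtain ⟨C₁, C₂, φ₀, δ₀, hC₁, hC₂, hφ₀, hδ₀, hest⟩ := hA.exists_norm_sub_le hr
    ((BanachScale.one_le_thresholdConst hr).trans_lt hb) (by linarith : 0 < c) h hκ
  have H : BanachScale.CutOffEstimate
      (fun δ e => ∀ f : Y, ‖f - fdag‖ ≤ δ → ∀ (α : WithTop ℝ) (u : X),
        BanachScale.IsDiscrepancyChoice G F D r ubar b c δ f α u → ‖u - udag‖ ≤ e)
      (fun γ => ‖BanachScale.lowPass G γ (udag - ubar)‖) a C₁ C₂ φ₀ δ₀ :=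
    ⟨hA.a_pos, hC₁, hC₂, hφ₀, hδ₀,
      fun δ e e' hee hQ f hf α u hu => (hQ f hf α u hu).trans hee, hest⟩
  obtain ⟨g, hg⟩ := BanachScale.mem_scaleSpace_one.1 hA.guess_mem.1
  have hB : 0 ≤ (1 + κ) * ‖g‖ := by positivity
  have hsplit : ∀ γ : ℝ, 0 < γ → ‖BanachScale.lowPass G γ (udag - ubar)‖ ≤
      ‖BanachScale.lowPass G γ udag‖ + (1 + κ) * ‖g‖ * γ := fun γ hγ => by
    rw [map_sub, ← hg]
    have := h.norm_lowPass_generator_le hγ g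
    linarith [norm_sub_le (BanachScale.lowPass G γ udag) (BanachScale.lowPass G γ (G g))]
  refine ⟨fun hcl ε hε => ?_, fun p hp hp1 hu => ?_, fun hu => ?_⟩
  · have hmem : udag - ubar ∈ closure (Set.range G) := by
      have h1 : udag ∈ (LinearMap.range (G : X →ₗ[ℝ] X)).topologicalClosure := hcl
      have h2 : ubar ∈ (LinearMap.range (G : X →ₗ[ℝ] X)).topologicalClosure :=
        subset_closure ⟨g, hg⟩
      exact sub_mem h1 h2
    exact H.exists_le_of_tendsto
      (fun ε hε => h.exists_norm_lowPass_le_of_mem_closure hκ hmem hε) hε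
  · obtain ⟨C, hC, hle⟩ := h.exists_norm_lowPass_le_of_mem_scaleSpace hκ hp hp1 hu
    refine H.exists_rpow_of_rpow hp (by linarith : 0 < C + (1 + κ) * ‖g‖ + 1)
      fun γ hγ hγ1 => (hsplit γ hγ).trans ?_
    have h1 : γ ≤ γ ^ p := by
      simpa using Real.rpow_le_rpow_of_exponent_ge hγ hγ1 hp1
    have h2 := mul_le_mul_of_nonneg_left h1 hB
    linarith [hle γ hγ, Real.rpow_pos_of_pos hγ p]
  · obtain ⟨C, γ₀, hC, hγ₀, hγ₀1, hle⟩ := h.exists_norm_lowPass_le_of_mem_logDomain hκ hu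
    refine H.exists_log_of_log (by linarith : 0 < C + (1 + κ) * ‖g‖) hγ₀
      fun γ hγ hγle => (hsplit γ hγ).trans ?_
    have hlog : 0 < Real.log (1 / γ) :=
      Real.log_pos (by rw [lt_div_iff₀ hγ]; linarith)
    have h1 : γ ≤ 1 / Real.log (1 / γ) := by
      rw [le_div_iff₀ hlog, ← le_div_iff₀' hγ]
      exact Real.log_le_self (by positivity)
    have h2 := mul_le_mul_of_nonneg_left h1 hB
    rw [add_div]
    exact add_le_add (hle γ hγ hγle) (h2.trans_eq (by ring))
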